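/- **Conventions.** All posets are finite. A *pure weighted graded poset of rank $d$* is a poset $P$ with a monotone rank function $\mathrm{rk}:P\to\{-1,0,\dots,d\}$ that increases by one along covers, a single element of rank $-1$, and every element below one of rank $d$, together with weights $m>0$ and transition probabilities $p_{z\to y}\ge 0$, positive exactly when $z$ covers $y$, such that $\sum_y p_{z\to y}=1$ whenever $\mathrm{rk}(z)\neq-1$, $m(x)=\sum_{z}p_{z\to x}m(z)$ for every non-maximal $x$, and $m=1$ at the element of rank $-1$. Put $P(l)=\mathrm{rk}^{-1}(l)$. The scheme is *standard* if $p_{z\to y}=1/N(z)$ for every $y$ covered by $z$, where $N(z)$ is the number of elements covered by $z$; it is then determined by the weights of the maximal elements. The *link* $P_x=\{y\ge x\}$ has rank function $\mathrm{rk}(y)-\mathrm{rk}(x)-1$, weights $m_x(y)=\frac{m(y)}{m(x)}c(y,x)$ and transition probabilities $(p_x)_{z\to y}=p_{z\to y}\,c(y,x)/c(z,x)$, where $c(y,x)$ is the sum over maximal chains from $y$ down to $x$ of the product of the transition probabilities along the chain. The *adjacency matrix* of $P$ acts on functions $f:P(0)\to\mathbb R$ by $$(Af)(y)=\sum_{x\ne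 y}\Big(\sum_{z\text{ covers }x,y}\frac{m(z)p_{z\to x}p_{z\to y}}{(1-p_{z\to y})\,m(y)}\Big)f(x).$$ A *non-trivial* eigenvalue is one with an eigenvector orthogonal to the constants for $\langle f,g\rangle=\sum_y m(y)f(y)g(y)$; the *second* eigenvalue, counted with multiplicity, is the largest non-trivial one. $P$ is *connected* if the upper walk $DU$ is irreducible on $P(0)$, where $(Ug)(y)=\sum_x p_{y\to x}g(x)$ and $(Df)(x)=\sum_y \frac{p_{y\to x}m(y)}{m(x)}f(y)$. $P$ of rank $d$ is *locally connected* if all links of elements of rank at most $d-2$ (including, for $d\ge1$, $P$ itself) are connected. **Theorem.** There are functions $B:\mathbb N^3\to\mathbb N$ and $f:\mathbb R\times\mathbb N^2\to\mathbb R$ with $f(\epsilon,d,q)\to0$ as $\epsilon\to0$ for all fixed $d,q$, such that the following holds. Let $\mathbb F_q$ be a finite field with $q$ elements and $X$ a pure $d$-dimensional simplicial complex with vertices in $[n]$ (a set of subsets of $[n]$, containing $\emptyset$ and closed under taking subsets), ordered by inclusion, graded by $|I|-1$ and endowed with a standard weight scheme $m$. Suppose that $X$ is locally connected, and that the link of every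 $(d-2)$-dimensional cell is, as a graph, regular and bipartite, with all non-trivial eigenvalues of its adjacency matrix at most $\epsilon$. Let $V$ be a vector space over $\mathbb F_q$ with basis $e_1,\dots,e_n$, put $V_I=\mathrm{span}\{e_i\mid i\in I\}$ for $I\subseteq[n]$, and let $$V_X=\{U\le V\mid U\subseteq V_I\text{ for some }I\in X\},$$ ordered by containment, with rank $\dim-1$ and the standard weight scheme determined by $m(V_I)=m(I)$ for every maximal $I\in X$. Then: 1. $V_X$ is a pure weighted graded poset of rank $d$, and it is a subposet of the poset of subspaces of $V$. 2. For every $Q\in\mathbb N$: if each cell of $X$ of dimension $k$, for every $k\ge0$, is contained in at most $Q$ cells of dimension $k+1$, then every element of $V_X$ of rank $k\ge0$ is covered by at most $B(q,Q,d)$ elements of rank $k+1$. 3. For every $x\in V_X$ of rank at most $d-2$, every non-trivial eigenvalue of the adjacency matrix of the link of $x$ in $V_X$ is at most $\frac{q-1}{q}+f(\epsilon,d,q)$, and every eigenvalue of that matrix is at least $-\frac1q$. -/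

import Mathlib

open Filter Topology

namespace PosetHDX

/-! ### Weighted graded posets -/

/-- A rank function together with a weight scheme on `P`: weights `m` and transition
probabilities `p`, where `p z y` is the probability of passing from `z` down to `y`.
The laws are collected in `WeightedGrading.IsWeightedGraded`. -/
structure WeightedGrading (P : Type*) where
  rk : P → ℤ
  m : P → ℝ
  p : P → P → ℝ

/-- The number of elements covered by `z`. -/
noncomputable def numCovered {P : Type*} [PartialOrder P] (z : P) : ℕ :=
  {y : P | y ⋖ z}.ncard

open Classical in
/-- The standard extension of a choice of weights on the maximal elements:
`m x = ∑_{y covers x} m y / N y` for every non-maximal `x`.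
The values of `w` at non-maximal elements are ignored. -/
noncomputable def standardWeight {P : Type*} [PartialOrder P] [Fintype P] (w : P → ℝ) (x : P) : ℝ :=
  if IsMax x then w x else ∑ y : {y : P // x ⋖ y}, standardWeight w y.1 / numCovered y.1
termination_by wellFounded_gt.wrap x
decreasing_by exact y.2.lt

open Classical in
/-- The standard weight scheme: all transition probabilities from `z` are `1 / N z`. -/
noncomputable def standardGrading {P : Type*} [PartialOrder P] [Fintype P] (rk : P → ℤ)
    (w : P → ℝ) : WeightedGrading P where
  rk := rk
  m := standardWeight w
  p := fun z y => if y ⋖ z then 1 / (numCovered z : ℝ) else 0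

/-- The elements above `x`, the underlying poset of the link of `x`. -/
abbrev Link {P : Type*} [PartialOrder P] (x : P) : Type _ := {y : P // x ≤ y}

noncomputable instance {P : Type*} [PartialOrder P] [Fintype P] (x : P) : Fintype (Link x) :=
  Fintype.ofFinite _

namespace WeightedGrading

variable {P : Type*} [PartialOrder P] [Fintype P]

open Classical in
/-- `P` is a pure weighted graded poset of rank `d`. -/
structure IsWeightedGraded (W : WeightedGrading P) (d : ℕ) : Prop where
  rk_ge : ∀ x, -1 ≤ W.rk x
  rk_mono : Monotone W.rk
  rk_covBy : ∀ a b, a ⋖ b → W.rk b = W.rk a + 1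
  existsUnique_bot : ∃! x, W.rk x = -1
  rk_le : ∀ x, W.rk x ≤ d
  pure : ∀ x, ∃ y, x ≤ y ∧ W.rk y = d
  m_pos : ∀ x, 0 < W.m x
  p_nonneg : ∀ z y, 0 ≤ W.p z y
  p_pos_iff : ∀ z y, 0 < W.p z y ↔ y ⋖ z
  p_sum : ∀ z, W.rk z ≠ -1 → ∑ y with y ⋖ z, W.p z y = 1
  m_eq : ∀ x, ¬ IsMax x → W.m x = ∑ z with x ⋖ z, W.p z x * W.m z
  m_bot : ∀ x, W.rk x = -1 → W.m x = 1

/-- `P(l)`, the elements of rank `l`. -/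
abbrev Level (W : WeightedGrading P) (l : ℤ) : Type _ := {x : P // W.rk x = l}

open Classical in
/-- The sum over all maximal (saturated) chains from `z` down to `x` of the product of the
transition probabilities along the chain. All these chains have `rk z - rk x` steps, so the sum
is an entry of a power of the transition matrix. -/
noncomputable def chainSum (W : WeightedGrading P) (z x : P) : ℝ :=
  ((Matrix.of W.p) ^ (W.rk z - W.rk x).toNat) z x

/-- The link of `x`, with the induced rank function, weights and transition probabilities. -/
noncomputable def link (W : WeightedGrading P) (x : P) : WeightedGrading (Link x) where
  rk := fun y => W.rk y.1 - W.rk x - 1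
  m := fun y => W.m y.1 / W.m x * W.chainSum y.1 x
  p := fun z y => W.p z.1 y.1 * W.chainSum y.1 x / W.chainSum z.1 x

open Classical in
/-- The operator `U`, `(U g) y = ∑_{x covered by y} p_{y → x} g x`. -/
noncomputable def up (W : WeightedGrading P) : (P → ℝ) →ₗ[ℝ] (P → ℝ) where
  toFun g := fun y => ∑ x with x ⋖ y, W.p y x * g x
  map_add' g h := by
    funext y
    simp [mul_add, Finset.sum_add_distrib]
  map_smul' c g := by
    funext y
    simp only [Pi.smul_apply, smul_eq_mul, RingHom.id_apply, Finset.mul_sum]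
    exact Finset.sum_congr rfl fun x _ => by ring

open Classical in
/-- The operator `D`, `(D f) x = ∑_{y covers x} p_{y → x} m y / m x * f y`. -/
noncomputable def down (W : WeightedGrading P) : (P → ℝ) →ₗ[ℝ] (P → ℝ) where
  toFun f := fun x => ∑ y with x ⋖ y, W.p y x * W.m y / W.m x * f y
  map_add' g h := by
    funext y
    simp [mul_add, Finset.sum_add_distrib]
  map_smul' c g := by
    funext y
    simp only [Pi.smul_apply, smul_eq_mul, RingHom.id_apply, Finset.mul_sum]
    exact Finset.sum_congr rfl fun x _ => by ring

/-- The upper walk `D U`, on all levels at once (it preserves the functions supported on a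
single level). -/
noncomputable def upperWalk (W : WeightedGrading P) : Module.End ℝ (P → ℝ) :=
  W.down ∘ₗ W.up

open Classical in
/-- Connectedness: the upper walk on `P(0)` is irreducible. -/
def IsConnected (W : WeightedGrading P) : Prop :=
  ∀ y z : P, W.rk y = 0 → W.rk z = 0 → ∃ j : ℕ, 0 < j ∧ (W.upperWalk ^ j) (Pi.single y 1) z ≠ 0

/-- Local connectedness in rank `d`: all links of elements of rank at most `d - 2` are connected
(for `d ≥ 1` this includes the link of the smallest element, which is the whole poset). -/
def IsLocallyConnected (W : WeightedGrading P) (d : ℕ) : Prop :=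
  ∀ x : P, W.rk x ≤ (d : ℤ) - 2 → (W.link x).IsConnected

open Classical in
/-- The `l`-th adjacency matrix, indexed by `P(l)`. -/
noncomputable def adjMatrix (W : WeightedGrading P) (l : ℤ) :
    Matrix (W.Level l) (W.Level l) ℝ :=
  Matrix.of fun y x => if x = y then 0 else
    ∑ z with x.1 ⋖ z ∧ y.1 ⋖ z,
      W.m z * W.p z x.1 * W.p z y.1 / ((1 - W.p z y.1) * W.m y.1)

/-- `c` is an eigenvalue of the zeroth adjacency matrix. -/
def IsEigenvalue (W : WeightedGrading P) (c : ℝ) : Prop :=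
  ∃ f : W.Level 0 → ℝ, f ≠ 0 ∧ (W.adjMatrix 0).mulVec f = c • f

/-- `c` is a non-trivial eigenvalue of the zeroth adjacency matrix: it has an eigenvector
orthogonal to the constants for the inner product `⟨f, g⟩ = ∑ m y f y g y`. The second largest
eigenvalue, counted with multiplicity, is the largest non-trivial one. -/
def IsNontrivialEigenvalue (W : WeightedGrading P) (c : ℝ) : Prop :=
  ∃ f : W.Level 0 → ℝ, f ≠ 0 ∧ ∑ y, W.m y.1 * f y = 0 ∧ (W.adjMatrix 0).mulVec f = c • f

/-- The underlying graph: vertices `P(0)`, two distinct vertices being adjacent when some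
element covers both. -/
def graph (W : WeightedGrading P) : SimpleGraph (W.Level 0) where
  Adj y z := y ≠ z ∧ ∃ u : P, y.1 ⋖ u ∧ z.1 ⋖ u
  symm := ⟨fun _ _ h => ⟨h.1.symm, h.2.imp fun _ hu => ⟨hu.2, hu.1⟩⟩⟩
  loopless := ⟨fun _ h => h.1 rfl⟩

/-- The underlying graph is a regular bipartite graph. -/
def IsRegularBipartite (W : WeightedGrading P) : Prop :=
  W.graph.IsBipartite ∧ ∃ k : ℕ, ∀ v, (W.graph.neighborSet v).ncard = k

end WeightedGrading

/-! ### Simplicial complexes and posetification -/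

/-- A simplicial complex, given by its set of faces, among which is the empty one. -/
structure IsSimplicialComplex {S : Type*} (X : Finset (Finset S)) : Prop where
  empty_mem : ∅ ∈ X
  down_closed : ∀ s ∈ X, ∀ t, t ⊆ s → t ∈ X

/-- The faces of `X` with rank `|I| - 1` and the standard weights extending `w`. -/
noncomputable def complexGrading {S : Type*} (X : Finset (Finset S)) (w : X → ℝ) :
    WeightedGrading X :=
  standardGrading (fun I => (I.1.card : ℤ) - 1) w

/-- The posetification of `X` along `φ`. -/
def posetification {S P : Type*} [PartialOrder P] (X : Finset (Finset S)) (φ : Finset S → P) :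
    Set P :=
  {y | ∃ I ∈ X, y ≤ φ I}

section Grassmannian

variable {S F V : Type*} [Field F] [AddCommGroup V] [Module F V]

/-- `V_I`, the span of the basis vectors indexed by `I`. -/
def coordSpan (e : Module.Basis S F V) (I : Finset S) : Submodule F V :=
  Submodule.span F (e '' (I : Set S))

/-- The posetification `V_X`, a set of subspaces of `V`, ordered by containment. -/
def grassmannianPosetification (e : Module.Basis S F V) (X : Finset (Finset S)) :
    Set (Submodule F V) :=
  posetification X (coordSpan e)

noncomputable instance [Fintype S] [Finite F] (e : Module.Basis S F V) (X : Finset (Finset S)) :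
    Fintype (grassmannianPosetification e X) :=
  haveI : Module.Finite F V := Module.Finite.of_basis e
  haveI : Finite V := Module.finite_of_finite F
  haveI : Finite (Submodule F V) := Finite.of_injective _ SetLike.coe_injective
  Fintype.ofFinite _

open Classical in
/-- `V_X` with rank `dim - 1` and the standard weights determined by `m (V_I) = w I` for every
maximal face `I` (for each maximal element of `V_X` the sum below has a single non-zero term). -/
noncomputable def grassmannianGrading [Fintype S] [Finite F] (e : Module.Basis S F V)
    (X : Finset (Finset S)) (w : X → ℝ) : WeightedGrading (grassmannianPosetification e X) :=
  standardGrading (fun y => (Module.finrank F y.1 : ℤ) - 1)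
    (fun y => ∑ I : X, if coordSpan e I.1 = y.1 then w I else 0)

end Grassmannian

end PosetHDX

/-!
The eigenvalues of the links of `V_X` are controlled by trickling down from the links of corank
two, where they can be computed from those of `X`.

*Weights.* Both `X` and `V_X` are regular posets (`IsRegularPoset`): covered elements, elements of
intervals and upper covers below a maximal element are counted by the rank alone, in `V_X` by the
numbers `[c] = 1 + q + ⋯ + q ^ (c - 1)`. Hence the standard weight of an element is a function of its
rank times the total weight of the facets above it (`IsRegularPoset.standardWeight_eq`). It follows
that `V_X` is a weighted graded poset, and that the adjacency matrix `A` of the link of `x` is an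
affine function of the walk from the covers of `x` to the facets and back
(`IsRegularPoset.sum_linkInc_mul_incSum`): an eigenvalue `λ` of `A` corresponds to the eigenvalue
`β = 1 + λ q [c - 1]` of the walk, where `c = d - rk x` is the corank of `x`.
The walk is positive semidefinite, so `β ≥ 0`, which is the lower bound
`λ ≥ - 1 / (q [c - 1]) ≥ - 1 / q`.

*Corank two.* Let `F t` be the sum of an eigenvector over the elements of the link below the facet
`t`. An element whose support is `t` lies below no other facet, so that the eigenvector is `F t / β`
there. The remaining elements below `t` are coordinate subspaces, at most two of them. If there are
two, then `x` itself is the coordinate subspace of a face, and the eigenvector restricts to an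
eigenvector of eigenvalue `β - q + 1` for the walk in the link of that face, a graph whose
non-trivial eigenvalues are at most `ε`. In all cases `β ≤ q + max ε 0`
(`grassmannian_incEigenBound_corank_two`).

*Trickling down.* Let the links of all covers of `x` satisfy `β' ≤ b`. An eigenvector `f` of the
link of `x` is localized at a cover `y` of `x` to the function that sends `z`, covering `y`, to the
sum of `f` over the covers of `x` below `z` other than `y`. The quadratic form bounds for these
functions sum up to `β (N - β) ≤ (b / N') (N - β) (β - 1 + N')`, where `N` and `N'` are the trivial
eigenvalues at `x` and at `y` (`IncEigen.trickle`). Since the links are connected, `β < N`, and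
`β ≤ b (N' - 1) / (N' - b)` results. With `b = q ^ (c - 1)` in corank `c` the right hand side is
`q ^ c`; this solution of the recursion corresponds to `λ = (q - 1) / q`, and the bounds started
from `q + max ε 0` tend to it as `ε` tends to `0` (`tendsto_spectralBound`). Connectedness of the
links is inherited from `X` (`grassmannian_link_connected`).

*Degrees.* An element of `V_X` of positive dimension has non-empty support, hence lies below a
bounded number of facets, each of which contains a bounded number of subspaces.
-/

set_option linter.unusedSectionVars false

namespace PosetHDX

/-! ### Weighted incidence structures -/

section Incidence

variable {T L Z : Type*} [Fintype T] [Fintype L] [Fintype Z]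

/-- The total weight of the points `t` incident with `l`. -/
def incWeight (w : T → ℝ) (R : L → T → ℝ) (l : L) : ℝ := ∑ t, R l t * w t

/-- The sum of `f` over the lines incident with `t`. -/
def incSum (R : L → T → ℝ) (f : L → ℝ) (t : T) : ℝ := ∑ l, R l t * f l

/-- `f` is an eigenvector, of eigenvalue `β`, of the walk from a line to a random point and back to
the sum over all lines, with the denominators cleared. Nothing is said about the values of `f` at
lines of weight zero. -/
def IncEigen (w : T → ℝ) (R : L → T → ℝ) (β : ℝ) (f : L → ℝ) : Prop :=
  ∀ l, ∑ t, R l t * w t * incSum R f t = β * (incWeight w R l * f l)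

/-- Every non-trivial eigenvalue of the walk is at most `b`. An eigenvector has to be non-zero at
some line of positive weight. -/
def IncEigenBound (w : T → ℝ) (R : L → T → ℝ) (b : ℝ) : Prop :=
  ∀ (f : L → ℝ) (β : ℝ), (∃ l, incWeight w R l ≠ 0 ∧ f l ≠ 0) →
    ∑ l, incWeight w R l * f l = 0 → IncEigen w R β f → β ≤ b

/-- The quadratic form of the walk, evaluated at an eigenvector. -/
theorem IncEigen.sum_mul_incSum {w : T → ℝ} {R : L → T → ℝ} {β : ℝ} {f : L → ℝ}
    (h : IncEigen w R β f) (g : L → ℝ) :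
    ∑ t, w t * (incSum R f t * incSum R g t) = β * ∑ l, incWeight w R l * f l * g l := by
  calc ∑ t, w t * (incSum R f t * incSum R g t)
      = ∑ t, ∑ l, R l t * w t * incSum R f t * g l := by
        refine Finset.sum_congr rfl fun t _ => ?_
        rw [incSum, incSum, ← incSum, Finset.mul_sum, Finset.mul_sum]
        exact Finset.sum_congr rfl fun l _ => by ring
    _ = ∑ l, (∑ t, R l t * w t * incSum R f t) * g l := by
        rw [Finset.sum_comm]
        exact Finset.sum_congr rfl fun l _ => by rw [Finset.sum_mul]
    _ = _ := by
        rw [Finset.mul_sum]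
        exact Finset.sum_congr rfl fun l _ => by rw [h l]; ring

theorem sum_mul_sum_incidence (w : T → ℝ) (R : L → T → ℝ) (g : L → ℝ) :
    ∑ t, w t * ∑ l, R l t * g l = ∑ l, incWeight w R l * g l := by
  simp only [incWeight, Finset.mul_sum, Finset.sum_mul]
  rw [Finset.sum_comm]
  exact Finset.sum_congr rfl fun l _ => Finset.sum_congr rfl fun t _ => by ring

/-- A symmetric real matrix all of whose eigenvalues are at most `b` is bounded by `b` as a
quadratic form. -/
theorem dotProduct_mulVec_le_of_eigenvalue_le [DecidableEq L] (S : Matrix L L ℝ)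
    (hS : S.IsHermitian) (b : ℝ)
    (h : ∀ (v : L → ℝ) (μ : ℝ), v ≠ 0 → S.mulVec v = μ • v → μ ≤ b) (x : L → ℝ) :
    x ⬝ᵥ S.mulVec x ≤ b * (x ⬝ᵥ x) := by
  have hA : (b • (1 : Matrix L L ℝ) - S).IsHermitian := by
    refine Matrix.IsHermitian.sub ?_ hS
    simp [Matrix.IsHermitian]
  have hpos : (b • (1 : Matrix L L ℝ) - S).PosSemidef := by
    rw [hA.posSemidef_iff_eigenvalues_nonneg]
    intro i
    have h1 := hA.mulVec_eigenvectorBasis i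
    have h2 := h (WithLp.ofLp (hA.eigenvectorBasis i)) (b - hA.eigenvalues i) ?_ ?_
    · simpa using h2
    · intro h0
      have := hA.eigenvectorBasis.orthonormal.ne_zero i
      exact this (by ext j; exact congrFun h0 j)
    · rw [Matrix.sub_mulVec, Matrix.smul_mulVec, Matrix.one_mulVec] at h1
      rw [sub_smul]
      rw [← h1]
      abel
  have h3 := hpos.dotProduct_mulVec_nonneg x
  rw [Matrix.sub_mulVec, Matrix.smul_mulVec, Matrix.one_mulVec, dotProduct_sub,
    dotProduct_smul] at h3
  simpa using h3

/-- The walk is self-adjoint, so a bound on its non-trivial eigenvalues bounds the quadratic form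
on the functions of mean zero. The matrix of the walk in the orthonormal coordinates
`√M l * f l`, less the projection to the constants, has only non-trivial eigenvalues and `0`. -/
theorem IncEigenBound.quadratic_le {w : T → ℝ} {R : L → T → ℝ} {b N : ℝ}
    (hb : 0 ≤ b) (hw : ∀ t, 0 ≤ w t) (hR : ∀ l t, 0 ≤ R l t)
    (hN : ∀ l t, R l t * ∑ l', R l' t = R l t * N) (h : IncEigenBound w R b) (g : L → ℝ)
    (hg : ∑ l, incWeight w R l * g l = 0) :
    ∑ t, w t * incSum R g t ^ 2 ≤ b * ∑ l, incWeight w R l * g l ^ 2 := by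
  classical
  set M := incWeight w R with hM
  have hM0 : ∀ l, 0 ≤ M l := fun l => Finset.sum_nonneg fun t _ => mul_nonneg (hR l t) (hw t)
  -- a line of weight zero is incident only with points of weight zero
  have hz : ∀ l, M l = 0 → ∀ t, R l t * w t = 0 := fun l hl t =>
    (Finset.sum_eq_zero_iff_of_nonneg fun t _ => mul_nonneg (hR l t) (hw t)).1 hl t
      (Finset.mem_univ t)
  set s : L → ℝ := fun l => √(M l) with hs
  have hss : ∀ l, s l * s l = M l := fun l => Real.mul_self_sqrt (hM0 l)
  have hs0 : ∀ l, s l = 0 → M l = 0 := fun l hl => by rw [← hss, hl, zero_mul]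
  set m := ∑ l, M l with hm
  set C : Matrix L L ℝ :=
    Matrix.of fun l l' => ∑ t, w t * (R l t / s l) * (R l' t / s l') with hC
  set C' : Matrix L L ℝ := C - Matrix.of (fun l l' => N / m * (s l * s l')) with hC'
  have hH : C'.IsHermitian := by
    ext l l'
    simp only [hC', hC, Matrix.conjTranspose_apply, Matrix.sub_apply, Matrix.of_apply,
      star_trivial]
    congr 1
    · exact Finset.sum_congr rfl fun t _ => by ring
    · ring
  have hCv : ∀ (v : L → ℝ) l, C.mulVec v l
      = ∑ t, w t * (R l t / s l) * incSum R (fun l' => v l' / s l') t := by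
    intro v l
    simp only [Matrix.mulVec, dotProduct, hC, Matrix.of_apply, Finset.sum_mul, incSum,
      Finset.mul_sum]
    rw [Finset.sum_comm]
    exact Finset.sum_congr rfl fun t _ => Finset.sum_congr rfl fun l' _ => by ring
  have hC'v : ∀ (v : L → ℝ) l, C'.mulVec v l = C.mulVec v l - N / m * (s ⬝ᵥ v) * s l := by
    intro v l
    rw [hC', Matrix.sub_mulVec, Pi.sub_apply]
    congr 1
    simp only [Matrix.mulVec, dotProduct, Matrix.of_apply, Finset.mul_sum, Finset.sum_mul]
    exact Finset.sum_congr rfl fun l' _ => by ring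
  have hwF : ∀ (f : L → ℝ) t, w t * incSum R (fun l' => s l' * f l' / s l') t
      = w t * incSum R f t := by
    intro f t
    simp only [incSum, Finset.mul_sum]
    refine Finset.sum_congr rfl fun l _ => ?_
    by_cases hl : s l = 0
    · have := hz l (hs0 l hl) t
      rw [← mul_assoc, ← mul_assoc, mul_comm (w t), this, zero_mul, zero_mul]
    · rw [mul_div_cancel_left₀ _ hl]
  have hC's : C'.mulVec s = 0 := by
    funext l
    rw [hC'v, hCv, Pi.zero_apply]
    have h1 : ∀ t, w t * (R l t / s l) * incSum R (fun l' => s l' / s l') t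
        = N / s l * (R l t * w t) := by
      intro t
      have := hwF 1 t
      simp only [Pi.one_apply, mul_one] at this
      rw [mul_right_comm, this]
      simp only [incSum, Pi.one_apply, mul_one]
      linear_combination (w t / s l) * hN l t
    rw [Finset.sum_congr rfl fun t _ => h1 t, ← Finset.mul_sum]
    change N / s l * M l - N / m * (∑ l', s l' * s l') * s l = 0
    simp only [hss]
    rw [← hm]
    by_cases hm0 : m = 0
    · have : M l = 0 := (Finset.sum_eq_zero_iff_of_nonneg fun l _ => hM0 l).1 hm0 l
        (Finset.mem_univ l)
      rw [this, hm0]; ring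
    · rw [div_mul_cancel₀ _ hm0, ← hss l]
      by_cases hl : s l = 0
      · simp [hl]
      · field_simp; ring
  have key := dotProduct_mulVec_le_of_eigenvalue_le C' hH b ?_ (fun l => s l * g l)
  · have e1 : (fun l => s l * g l) ⬝ᵥ (fun l => s l * g l) = ∑ l, M l * g l ^ 2 := by
      simp only [dotProduct]
      exact Finset.sum_congr rfl fun l _ => by rw [← hss]; ring
    have e2 : s ⬝ᵥ (fun l => s l * g l) = 0 := by
      rw [← hg]
      simp only [dotProduct]
      exact Finset.sum_congr rfl fun l _ => by rw [← hss]; ring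
    have e3 : (fun l => s l * g l) ⬝ᵥ C'.mulVec (fun l => s l * g l)
        = ∑ t, w t * incSum R g t ^ 2 := by
      have : ∀ l, C'.mulVec (fun l => s l * g l) l
          = ∑ t, (R l t / s l) * (w t * incSum R g t) := by
        intro l
        rw [hC'v, e2, hCv]
        simp only [mul_zero, zero_mul, sub_zero]
        refine Finset.sum_congr rfl fun t _ => ?_
        rw [← hwF]; ring
      simp only [dotProduct, this, Finset.mul_sum]
      rw [Finset.sum_comm]
      refine Finset.sum_congr rfl fun t _ => ?_
      have h1 : ∀ l, s l * g l * (R l t / s l * (w t * incSum R g t))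
          = incSum R g t * (w t * (R l t * (s l * g l / s l))) := fun l => by ring
      rw [Finset.sum_congr rfl fun l _ => h1 l, ← Finset.mul_sum, ← Finset.mul_sum]
      have := hwF g t
      rw [incSum] at this
      rw [this]; ring
    rwa [e1, e3] at key
  · intro v μ hv hμ
    by_cases hμ0 : μ = 0
    · rw [hμ0]; exact hb
    have hsv : s ⬝ᵥ v = 0 := by
      have h1 : μ * (s ⬝ᵥ v) = 0 := by
        rw [← smul_eq_mul, ← dotProduct_smul, ← hμ, Matrix.dotProduct_mulVec,
          ← Matrix.mulVec_transpose]
        have : C'.transpose = C' := by simpa [Matrix.IsHermitian] using hH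
        rw [this, hC's, zero_dotProduct]
      exact (mul_eq_zero.1 h1).resolve_left hμ0
    have hv' : ∀ l, ∑ t, w t * (R l t / s l) * incSum R (fun l' => v l' / s l') t = μ * v l := by
      intro l
      have := congrFun hμ l
      rw [hC'v, hsv, hCv] at this
      simpa using this
    have hv0 : ∀ l, s l = 0 → v l = 0 := by
      intro l hl
      have := hv' l
      simp only [hl, div_zero, mul_zero, zero_mul, Finset.sum_const_zero] at this
      exact (mul_eq_zero.1 this.symm).resolve_left hμ0
    refine h (fun l => v l / s l) μ ?_ ?_ ?_
    · obtain ⟨l, hl⟩ := Function.ne_iff.1 hv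
      have hsl : s l ≠ 0 := fun h0 => hl (hv0 l h0)
      exact ⟨l, fun h0 => hsl (by simp only [hs, hM, h0, Real.sqrt_zero]), div_ne_zero hl hsl⟩
    · rw [← hsv]
      simp only [dotProduct]
      refine Finset.sum_congr rfl fun l _ => ?_
      rw [← hM, ← hss]
      by_cases hl : s l = 0
      · simp [hl]
      · field_simp
    · intro l
      rw [← hM]
      by_cases hl : s l = 0
      · have := hz l (hs0 l hl)
        simp [this, hl]
      · have : ∑ t, R l t * w t * incSum R (fun l' => v l' / s l') t
            = s l * ∑ t, w t * (R l t / s l) * incSum R (fun l' => v l' / s l') t := by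
          rw [Finset.mul_sum]
          refine Finset.sum_congr rfl fun t _ => ?_
          field_simp
        rw [this, hv', ← hss]
        field_simp

theorem incNormSq_pos {w : T → ℝ} {R : L → T → ℝ} {f : L → ℝ}
    (hw : ∀ t, 0 ≤ w t) (hR : ∀ l t, 0 ≤ R l t)
    (hf : ∃ l, incWeight w R l ≠ 0 ∧ f l ≠ 0) : 0 < ∑ l, incWeight w R l * f l ^ 2 := by
  have hM0 : ∀ l, 0 ≤ incWeight w R l := fun l =>
    Finset.sum_nonneg fun t _ => mul_nonneg (hR l t) (hw t)
  obtain ⟨l, hl, hfl⟩ := hf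
  refine Finset.sum_pos' (fun l _ => mul_nonneg (hM0 l) (sq_nonneg _))
    ⟨l, Finset.mem_univ l, mul_pos (lt_of_le_of_ne (hM0 l) hl.symm) (by positivity)⟩

theorem IncEigen.sum_mul_incSum_sq {w : T → ℝ} {R : L → T → ℝ} {β : ℝ} {f : L → ℝ}
    (h : IncEigen w R β f) :
    ∑ t, w t * incSum R f t ^ 2 = β * ∑ l, incWeight w R l * f l ^ 2 := by
  have := h.sum_mul_incSum f
  simpa only [sq, mul_assoc] using this

theorem IncEigen.nonneg {w : T → ℝ} {R : L → T → ℝ} {β : ℝ} {f : L → ℝ}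
    (hw : ∀ t, 0 ≤ w t) (hR : ∀ l t, 0 ≤ R l t)
    (hf : ∃ l, incWeight w R l ≠ 0 ∧ f l ≠ 0) (h : IncEigen w R β f) : 0 ≤ β := by
  have h1 := h.sum_mul_incSum_sq
  have h2 := incNormSq_pos hw hR hf
  have h3 : 0 ≤ ∑ t, w t * incSum R f t ^ 2 :=
    Finset.sum_nonneg fun t _ => mul_nonneg (hw t) (sq_nonneg _)
  rw [h1] at h3
  exact nonneg_of_mul_nonneg_left h3 h2

theorem incSum_mul_sum {R : L → T → ℝ} {N : ℝ}
    (hN : ∀ l t, R l t * ∑ l', R l' t = R l t * N) (f : L → ℝ) (t : T) :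
    incSum R f t * ∑ l, R l t = incSum R f t * N := by
  rw [incSum, Finset.sum_mul, Finset.sum_mul]
  exact Finset.sum_congr rfl fun l _ => by linear_combination f l * hN l t

theorem sum_mul_sum_sub_sq {w : T → ℝ} {R : L → T → ℝ} {β N : ℝ} {f : L → ℝ}
    (hN : ∀ l t, R l t * ∑ l', R l' t = R l t * N) (h : IncEigen w R β f) (a b : ℝ) :
    ∑ t, w t * ∑ l, R l t * (a * incSum R f t - b * f l) ^ 2
      = (a ^ 2 * N * β - 2 * a * b * β + b ^ 2) * ∑ l, incWeight w R l * f l ^ 2 := by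
  have h1 : ∀ t, w t * ∑ l, R l t * (a * incSum R f t - b * f l) ^ 2
      = (a ^ 2 * N - 2 * a * b) * (w t * incSum R f t ^ 2)
        + b ^ 2 * (w t * ∑ l, R l t * f l ^ 2) := by
    intro t
    have : ∀ l, R l t * (a * incSum R f t - b * f l) ^ 2
        = a ^ 2 * incSum R f t ^ 2 * R l t - 2 * a * b * incSum R f t * (R l t * f l)
          + b ^ 2 * (R l t * f l ^ 2) := fun l => by ring
    rw [Finset.sum_congr rfl fun l _ => this l, Finset.sum_add_distrib, Finset.sum_sub_distrib,
      ← Finset.mul_sum, ← Finset.mul_sum, ← Finset.mul_sum]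
    rw [show ∑ l, R l t * f l = incSum R f t from rfl]
    linear_combination (w t * a ^ 2 * incSum R f t) * incSum_mul_sum hN f t
  rw [Finset.sum_congr rfl fun t _ => h1 t, Finset.sum_add_distrib, ← Finset.mul_sum,
    ← Finset.mul_sum, h.sum_mul_incSum_sq, sum_mul_sum_incidence w R fun l => f l ^ 2]
  ring

/-- In a connected incidence structure with `N` lines through every point, the trivial
eigenvalue `N` is simple. -/
theorem IncEigen.lt_of_connected {w : T → ℝ} {R : L → T → ℝ} {β N : ℝ} {f : L → ℝ}
    (hN0 : 0 < N) (hw : ∀ t, 0 ≤ w t) (hR : ∀ l t, 0 ≤ R l t)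
    (hN : ∀ l t, R l t * ∑ l', R l' t = R l t * N) (hf : ∃ l, incWeight w R l ≠ 0 ∧ f l ≠ 0)
    (hsum : ∑ l, incWeight w R l * f l = 0) (h : IncEigen w R β f)
    (hconn : ∀ f : L → ℝ,
      (∀ l l' t, R l t ≠ 0 → R l' t ≠ 0 → w t ≠ 0 → f l = f l') →
      ∀ l l', incWeight w R l ≠ 0 → incWeight w R l' ≠ 0 → f l = f l') : β < N := by
  by_contra! hle
  have hpos := incNormSq_pos hw hR hf
  have h1 := sum_mul_sum_sub_sq hN h 1 N
  have h2 : ∀ t, 0 ≤ w t * ∑ l, R l t * (1 * incSum R f t - N * f l) ^ 2 := fun t =>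
    mul_nonneg (hw t) (Finset.sum_nonneg fun l _ => mul_nonneg (hR l t) (sq_nonneg _))
  have h3 : ∑ t, w t * ∑ l, R l t * (1 * incSum R f t - N * f l) ^ 2 = 0 := by
    refine le_antisymm ?_ (Finset.sum_nonneg fun t _ => h2 t)
    rw [h1]
    refine mul_nonpos_of_nonpos_of_nonneg ?_ hpos.le
    nlinarith
  have h4 := (Finset.sum_eq_zero_iff_of_nonneg fun t _ => h2 t).1 h3
  have h5 : ∀ l t, R l t ≠ 0 → w t ≠ 0 → incSum R f t = N * f l := by
    intro l t hl ht
    have h6 := (mul_eq_zero.1 (h4 t (Finset.mem_univ t))).resolve_left ht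
    have h7 := (Finset.sum_eq_zero_iff_of_nonneg fun l _ =>
      mul_nonneg (hR l t) (sq_nonneg _)).1 h6 l (Finset.mem_univ l)
    have h8 := (mul_eq_zero.1 h7).resolve_left hl
    have h9 := pow_eq_zero_iff (two_ne_zero) |>.1 h8
    linarith
  have hc := hconn f fun l l' t hl hl' ht =>
    mul_left_cancel₀ hN0.ne' ((h5 l t hl ht).symm.trans (h5 l' t hl' ht))
  obtain ⟨l₀, hl₀, hfl₀⟩ := hf
  have h10 : ∑ l, incWeight w R l * f l ^ 2 = f l₀ * ∑ l, incWeight w R l * f l := by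
    rw [Finset.mul_sum]
    refine Finset.sum_congr rfl fun l _ => ?_
    by_cases hl : incWeight w R l = 0
    · rw [hl]; ring
    · rw [hc l l₀ hl hl₀]; ring
  rw [hsum, mul_zero] at h10
  exact hpos.ne' h10

/-- Trickling down. Lines `l`, planes `z` and points `t` are such that two lines through `t` span
a single plane, every line in `t` lies in `N'` planes in `t`, and a plane contains `q + 1` lines.
An eigenvector `f` is localized at a line `l` to the function `z ↦ ∑ f l'` over the
lines `l' ≠ l` of `z`. Subtracting its mean and summing the quadratic form bound `b` on the
links of all lines gives the inequality. -/
theorem IncEigen.trickle {w : T → ℝ} {R : L → T → ℝ} {Q : L → Z → ℝ} {P : Z → T → ℝ}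
    {β N N' q b : ℝ} {f : L → ℝ} (hN'0 : 0 < N') (hNN' : N = q * N' + 1)
    (hw : ∀ t, 0 ≤ w t) (hR : ∀ l t, 0 ≤ R l t) (hRR : ∀ l t, R l t * R l t = R l t)
    (hQQ : ∀ l z, Q l z * Q l z = Q l z)
    (hN : ∀ l t, R l t * ∑ l', R l' t = R l t * N)
    (hQP : ∀ l t, ∑ z, Q l z * P z t = N' * R l t)
    (hQPQ : ∀ l l' t, l ≠ l' → ∑ z, Q l z * P z t * Q l' z = R l t * R l' t)
    (hq : ∀ z t, P z t * ∑ l, Q l z = P z t * (q + 1))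
    (hloc : ∀ (l : L) (g : Z → ℝ), ∑ z, incWeight w (fun z t => Q l z * P z t) z * g z = 0 →
      ∑ t, w t * incSum (fun z t => Q l z * P z t) g t ^ 2
        ≤ b * ∑ z, incWeight w (fun z t => Q l z * P z t) z * g z ^ 2)
    (hf : ∃ l, incWeight w R l ≠ 0 ∧ f l ≠ 0) (h : IncEigen w R β f) (hβ : β < N) :
    β * N' ≤ b * (β + N' - 1) := by
  classical
  have hpos := incNormSq_pos hw hR hf
  set F := incSum R f with hF
  set G : Z → ℝ := fun z => ∑ l, Q l z * f l with hG
  set γ : ℝ := 1 + (β - 1) / N' with hγ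
  have hγN : γ * N' = β + N' - 1 := by rw [hγ]; field_simp; ring
  -- the sum of `G` over the planes of `t` through `l`
  have hΦG : ∀ l t, ∑ z, Q l z * P z t * G z = R l t * (F t + (N' - 1) * f l) := by
    intro l t
    have h1 : ∀ l', ∑ z, Q l z * P z t * (Q l' z * f l')
        = R l t * (R l' t * f l') + if l' = l then (N' - 1) * R l t * f l else 0 := by
      intro l'
      by_cases hl : l' = l
      · subst hl
        rw [if_pos rfl]
        have h2 : ∀ z, Q l' z * P z t * (Q l' z * f l') = Q l' z * P z t * f l' := fun z => by
          rw [← mul_assoc, mul_right_comm (Q l' z), hQQ]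
        rw [Finset.sum_congr rfl fun z _ => h2 z, ← Finset.sum_mul, hQP, ← mul_assoc, hRR]
        ring
      · rw [if_neg hl, add_zero, ← mul_assoc, ← hQPQ l l' t (Ne.symm hl), Finset.sum_mul]
        exact Finset.sum_congr rfl fun z _ => by ring
    simp only [hG, Finset.mul_sum]
    rw [Finset.sum_comm, Finset.sum_congr rfl fun l' _ => h1 l', Finset.sum_add_distrib,
      Finset.sum_ite_eq', if_pos (Finset.mem_univ l), ← Finset.mul_sum]
    rw [hF, incSum]
    ring
  have hlocsum : ∀ l t, incSum (fun z t => Q l z * P z t) (fun z => G z - γ * f l) t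
      = R l t * (1 * F t - β * f l) := by
    intro l t
    have h1 : ∀ z, Q l z * P z t * (G z - γ * f l)
        = Q l z * P z t * G z - γ * f l * (Q l z * P z t) := fun z => by ring
    rw [incSum, Finset.sum_congr rfl fun z _ => h1 z, Finset.sum_sub_distrib, ← Finset.mul_sum,
      hΦG, hQP]
    linear_combination (-R l t * f l) * hγN
  have hmean : ∀ l, ∑ z, incWeight w (fun z t => Q l z * P z t) z * (G z - γ * f l) = 0 := by
    intro l
    rw [← sum_mul_sum_incidence]
    have h1 : ∀ t, w t * ∑ z, Q l z * P z t * (G z - γ * f l)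
        = R l t * w t * F t - β * f l * (R l t * w t) := fun t => by
      have := hlocsum l t
      rw [incSum] at this
      rw [this]; ring
    rw [Finset.sum_congr rfl fun t _ => h1 t, Finset.sum_sub_distrib, ← Finset.mul_sum, h l,
      incWeight]
    ring
  have hsum := Finset.sum_le_sum fun l (_ : l ∈ Finset.univ) => hloc l _ (hmean l)
  have hleft : ∑ l, ∑ t, w t * incSum (fun z t => Q l z * P z t) (fun z => G z - γ * f l) t ^ 2
      = β * (N - β) * ∑ l, incWeight w R l * f l ^ 2 := by
    rw [Finset.sum_comm]
    have h1 : ∀ t, ∑ l, w t * incSum (fun z t => Q l z * P z t) (fun z => G z - γ * f l) t ^ 2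
        = w t * ∑ l, R l t * (1 * F t - β * f l) ^ 2 := by
      intro t
      rw [Finset.mul_sum]
      refine Finset.sum_congr rfl fun l _ => ?_
      rw [hlocsum, mul_pow, sq (R l t), hRR]
    rw [Finset.sum_congr rfl fun t _ => h1 t, sum_mul_sum_sub_sq hN h]
    ring
  have hright : ∑ l, b * ∑ z, incWeight w (fun z t => Q l z * P z t) z * (G z - γ * f l) ^ 2
      = b * ((q + 1 - γ) * (β + N' - 1)) * ∑ l, incWeight w R l * f l ^ 2 := by
    rw [← Finset.mul_sum, mul_assoc]
    congr 1
    have h1 : ∀ l, ∑ z, incWeight w (fun z t => Q l z * P z t) z * (G z - γ * f l) ^ 2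
        = ∑ t, w t * ∑ z, Q l z * P z t * (G z - γ * f l) ^ 2 := fun l =>
      (sum_mul_sum_incidence w (fun z t => Q l z * P z t) fun z => (G z - γ * f l) ^ 2).symm
    rw [Finset.sum_congr rfl fun l _ => h1 l, Finset.sum_comm]
    have h2 : ∀ t, ∑ l, w t * ∑ z, Q l z * P z t * (G z - γ * f l) ^ 2
        = (q + 1 - 2 * γ) * (w t * F t ^ 2)
          + ((q + 1 - 2 * γ) * (N' - 1) + γ ^ 2 * N') * (w t * ∑ l, R l t * f l ^ 2) := by
      intro t
      have h3 : ∑ l, ∑ z, Q l z * P z t * G z ^ 2 = (q + 1) * ∑ z, P z t * G z ^ 2 := by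
        rw [Finset.sum_comm, Finset.mul_sum]
        refine Finset.sum_congr rfl fun z _ => ?_
        rw [← Finset.sum_mul, ← Finset.sum_mul, mul_comm (∑ l, Q l z), hq]
        ring
      have h4 : ∑ l, f l * ∑ z, Q l z * P z t * G z
          = F t ^ 2 + (N' - 1) * ∑ l, R l t * f l ^ 2 := by
        have h5 : ∀ l, f l * ∑ z, Q l z * P z t * G z
            = F t * (R l t * f l) + (N' - 1) * (R l t * f l ^ 2) := fun l => by rw [hΦG]; ring
        rw [Finset.sum_congr rfl fun l _ => h5 l, Finset.sum_add_distrib, ← Finset.mul_sum,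
          ← Finset.mul_sum]
        rw [show ∑ l, R l t * f l = F t from rfl]
        ring
      have h6 : ∑ l, f l * ∑ z, Q l z * P z t * G z = ∑ z, P z t * G z ^ 2 := by
        simp only [Finset.mul_sum]
        rw [Finset.sum_comm]
        refine Finset.sum_congr rfl fun z _ => ?_
        have : ∀ l, f l * (Q l z * P z t * G z) = P z t * G z * (Q l z * f l) := fun l => by ring
        rw [Finset.sum_congr rfl fun l _ => this l, ← Finset.mul_sum]
        rw [show ∑ l, Q l z * f l = G z from rfl]
        ring
      have h7 : ∀ l, ∑ z, Q l z * P z t * (G z - γ * f l) ^ 2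
          = ∑ z, Q l z * P z t * G z ^ 2 - 2 * γ * (f l * ∑ z, Q l z * P z t * G z)
            + γ ^ 2 * N' * (R l t * f l ^ 2) := by
        intro l
        have : γ ^ 2 * N' * (R l t * f l ^ 2) = γ ^ 2 * f l ^ 2 * ∑ z, Q l z * P z t := by
          rw [hQP]; ring
        rw [this, Finset.mul_sum, Finset.mul_sum, Finset.mul_sum, ← Finset.sum_sub_distrib,
          ← Finset.sum_add_distrib]
        exact Finset.sum_congr rfl fun z _ => by ring
      rw [← Finset.mul_sum, Finset.sum_congr rfl fun l _ => h7 l, Finset.sum_add_distrib,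
        Finset.sum_sub_distrib, ← Finset.mul_sum, ← Finset.mul_sum, h3, ← h6, h4]
      ring
    rw [Finset.sum_congr rfl fun t _ => h2 t, Finset.sum_add_distrib, ← Finset.mul_sum,
      ← Finset.mul_sum, h.sum_mul_incSum_sq, sum_mul_sum_incidence w R fun l => f l ^ 2]
    linear_combination (γ * ∑ l, incWeight w R l * f l ^ 2) * hγN
  rw [hleft, hright] at hsum
  have h8 := le_of_mul_le_mul_right hsum hpos
  have h9 : (q + 1 - γ) * N' = N - β := by rw [hNN']; linear_combination -hγN
  have h10 : (β * N') * (N - β) ≤ (b * (β + N' - 1)) * (N - β) := by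
    calc (β * N') * (N - β) = β * (N - β) * N' := by ring
      _ ≤ b * ((q + 1 - γ) * (β + N' - 1)) * N' := mul_le_mul_of_nonneg_right h8 hN'0.le
      _ = (b * (β + N' - 1)) * ((q + 1 - γ) * N') := by ring
      _ = _ := by rw [h9]
  exact le_of_mul_le_mul_right h10 (by linarith)

end Incidence
/-! ### Counting subspaces -/

/-- The number `1 + q + ⋯ + q ^ (n - 1)` of points of an `n`-dimensional space over the field
with `q` elements. -/
def gaussNum (q n : ℕ) : ℕ := ∑ i ∈ Finset.range n, q ^ i

@[simp] theorem gaussNum_zero (q : ℕ) : gaussNum q 0 = 0 := by simp [gaussNum]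

@[simp] theorem gaussNum_one (q : ℕ) : gaussNum q 1 = 1 := by simp [gaussNum]

theorem gaussNum_succ (q n : ℕ) : gaussNum q (n + 1) = q * gaussNum q n + 1 := by
  simp [gaussNum, Finset.sum_range_succ', Finset.mul_sum, pow_succ']

theorem gaussNum_succ' (q n : ℕ) : gaussNum q (n + 1) = gaussNum q n + q ^ n := by
  simp [gaussNum, Finset.sum_range_succ]

theorem gaussNum_two (q : ℕ) : gaussNum q 2 = q + 1 := by simp [gaussNum_succ]

theorem gaussNum_pos (q : ℕ) {n : ℕ} (hn : 0 < n) : 0 < gaussNum q n := by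
  obtain ⟨n, rfl⟩ := Nat.exists_eq_succ_of_ne_zero hn.ne'
  rw [gaussNum_succ]; omega

section Subspaces

variable {F V : Type*} [Field F] [AddCommGroup V] [Module F V]

theorem submodule_covBy_iff_finrank [Module.Finite F V] {U W : Submodule F V} :
    U ⋖ W ↔ U ≤ W ∧ Module.finrank F W = Module.finrank F U + 1 := by
  constructor
  · intro h
    refine ⟨h.le, ?_⟩
    obtain ⟨v, hvW, hvU⟩ := SetLike.exists_of_lt h.lt
    have hlt : U < U ⊔ Submodule.span F {v} := by
      refine lt_of_le_of_ne le_sup_left fun he => hvU ?_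
      rw [he]
      exact le_sup_right (a := U) (Submodule.mem_span_singleton_self v)
    have hle : U ⊔ Submodule.span F {v} ≤ W :=
      sup_le h.le (by simpa [Submodule.span_singleton_le_iff_mem] using hvW)
    have he : U ⊔ Submodule.span F {v} = W := hle.eq_of_not_lt fun hl => h.2 hlt hl
    have h1 := Submodule.finrank_add_le_finrank_add_finrank U (Submodule.span F {v})
    have h2 := finrank_span_singleton (K := F) (v := v) fun h0 => hvU (h0 ▸ U.zero_mem)
    have h3 := Submodule.finrank_lt_finrank_of_lt h.lt
    rw [he] at h1
    omega
  · rintro ⟨hle, hr⟩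
    refine ⟨lt_of_le_of_ne hle fun he => by rw [he] at hr; omega, fun c h1 h2 => ?_⟩
    have := Submodule.finrank_lt_finrank_of_lt h1
    have := Submodule.finrank_lt_finrank_of_lt h2
    omega

theorem ncard_finrank_eq_one [Fintype F] :
    {H : Submodule F V | Module.finrank F H = 1}.ncard
      = gaussNum (Fintype.card F) (Module.finrank F V) := by
  rw [← Nat.card_coe_set_eq, gaussNum, ← Nat.card_eq_fintype_card,
    ← Projectivization.card_of_finrank F V rfl]
  exact Nat.card_congr (Projectivization.equivSubmodule F V).symm

theorem ncard_covBy_and_le [Fintype F] [Module.Finite F V] {U Z : Submodule F V} (h : U ≤ Z) :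
    {W : Submodule F V | U ⋖ W ∧ W ≤ Z}.ncard
      = gaussNum (Fintype.card F) (Module.finrank F Z - Module.finrank F U) := by
  set U' : Submodule F Z := U.comap Z.subtype with hU'
  have hr : Module.finrank F U' = Module.finrank F U :=
    (Submodule.comapSubtypeEquivOfLe h).finrank_eq
  let φ : Submodule F (Z ⧸ U') ↪o Submodule F V :=
    (Submodule.comapMkQOrderEmbedding U').trans (Submodule.MapSubtype.orderEmbedding Z)
  have hφ : ∀ H, φ H = (H.comap U'.mkQ).map Z.subtype := fun H => rfl
  have hbot : φ ⊥ = U := by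
    rw [hφ, Submodule.comap_bot, Submodule.ker_mkQ, hU', Submodule.map_comap_subtype]
    exact inf_eq_right.2 h
  have hrange : ∀ W, W ∈ Set.range φ ↔ U ≤ W ∧ W ≤ Z := by
    intro W
    constructor
    · rintro ⟨H, rfl⟩
      exact ⟨hbot ▸ φ.monotone bot_le, Submodule.map_subtype_le _ _⟩
    · rintro ⟨h1, h2⟩
      refine ⟨(W.comap Z.subtype).map U'.mkQ, ?_⟩
      rw [hφ, Submodule.comap_map_mkQ, sup_eq_right.2 (Submodule.comap_mono h1),
        Submodule.map_comap_subtype]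
      exact inf_eq_right.2 h2
  have hoc : (Set.range φ).OrdConnected := by
    have : Set.range φ = Set.Icc U Z := Set.ext hrange
    rw [this]; exact Set.ordConnected_Icc
  have himage : {W : Submodule F V | U ⋖ W ∧ W ≤ Z}
      = φ '' {H | Module.finrank F H = 1} := by
    ext W
    constructor
    · rintro ⟨h1, h2⟩
      obtain ⟨H, rfl⟩ := (hrange W).2 ⟨h1.le, h2⟩
      refine ⟨H, ?_, rfl⟩
      rw [← hbot, hoc.apply_covBy_apply_iff, bot_covBy_iff] at h1
      exact Submodule.isAtom_iff_finrank_eq_one.1 h1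
    · rintro ⟨H, hH, rfl⟩
      refine ⟨?_, ((hrange _).1 ⟨H, rfl⟩).2⟩
      rw [← hbot, hoc.apply_covBy_apply_iff, bot_covBy_iff]
      exact Submodule.isAtom_iff_finrank_eq_one.2 hH
  rw [himage, Set.ncard_image_of_injective _ φ.injective, ncard_finrank_eq_one]
  congr 1
  have := Submodule.finrank_quotient_add_finrank U'
  omega

theorem ncard_covBy_left [Fintype F] [Module.Finite F V] (Z : Submodule F V) :
    {W : Submodule F V | W ⋖ Z}.ncard = gaussNum (Fintype.card F) (Module.finrank F Z) := by
  have e1 : {W : Submodule F V | W ⋖ Z}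
      = Submodule.map Z.subtype '' {W' : Submodule F Z | IsCoatom W'} := by
    ext W
    constructor
    · intro h
      refine ⟨Z.mapIic.symm ⟨W, h.le⟩, ?_, ?_⟩
      · rw [Set.mem_ofPred_eq, OrderIso.isCoatom_iff, Set.Iic.isCoatom_iff]
        exact h
      · rw [← Submodule.coe_mapIic_apply, OrderIso.apply_symm_apply]
    · rintro ⟨W', hW', rfl⟩
      rw [Set.mem_ofPred_eq, ← Submodule.coe_mapIic_apply, ← Set.Iic.isCoatom_iff,
        OrderIso.isCoatom_iff]
      exact hW'
  have e2 : {W' : Submodule F Z | IsCoatom W'}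
      = Submodule.dualCoannihilator '' {H : Submodule F (Module.Dual F Z) |
          Module.finrank F H = 1} := by
    ext W
    rw [Set.mem_ofPred_eq, ← (Subspace.orderIsoFiniteDimensional (K := F) (V := Z)).isCoatom_iff,
      ← OrderDual.ofDual_toDual (Subspace.orderIsoFiniteDimensional W), OrderDual.ofDual_toDual]
    constructor
    · intro h
      refine ⟨_, Submodule.isAtom_iff_finrank_eq_one.1 (isCoatom_dual_iff_isAtom.1 h),
        (Subspace.orderIsoFiniteDimensional (K := F) (V := Z)).symm_apply_apply W⟩
    · rintro ⟨H, hH, rfl⟩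
      have := (Subspace.orderIsoFiniteDimensional (K := F) (V := Z)).apply_symm_apply
        (OrderDual.toDual H)
      change IsCoatom (Subspace.orderIsoFiniteDimensional
        ((Subspace.orderIsoFiniteDimensional (K := F) (V := Z)).symm (OrderDual.toDual H)))
      rw [this]
      exact isCoatom_dual_iff_isAtom.2 (Submodule.isAtom_iff_finrank_eq_one.2 hH)
  rw [e1, Set.ncard_image_of_injective _ (Submodule.map_injective_of_injective
    (Submodule.injective_subtype Z)), e2, Set.InjOn.ncard_image, ncard_finrank_eq_one,
    Subspace.dual_finrank_eq]
  intro H _ H' _ hHH'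
  exact (Subspace.orderIsoFiniteDimensional (K := F) (V := Z)).symm.injective
    (a₁ := OrderDual.toDual H) (a₂ := OrderDual.toDual H') hHH'

end Subspaces

/-! ### Coordinate subspaces -/

section CoordSpan

variable {S F V : Type*} [Field F] [AddCommGroup V] [Module F V]

theorem mem_coordSpan {e : Module.Basis S F V} {I : Finset S} {v : V} :
    v ∈ coordSpan e I ↔ (e.repr v).support ⊆ I := by
  rw [coordSpan, Module.Basis.mem_span_image, Finset.coe_subset]

theorem finrank_coordSpan (e : Module.Basis S F V) (I : Finset S) :
    Module.finrank F (coordSpan e I) = I.card := by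
  have h := finrank_span_eq_card (R := F) (b := fun i : I => e i)
    (e.linearIndependent.comp _ Subtype.val_injective)
  rw [Fintype.card_coe] at h
  rw [coordSpan, Set.image_eq_range]
  exact h

theorem coordSpan_le_coordSpan {e : Module.Basis S F V} {I J : Finset S} :
    coordSpan e I ≤ coordSpan e J ↔ I ⊆ J := by
  constructor
  · intro h i hi
    have h1 : e i ∈ coordSpan e I := Submodule.subset_span ⟨i, hi, rfl⟩
    have h2 := mem_coordSpan.1 (h h1)
    rw [e.repr_self, Finsupp.support_single i one_ne_zero] at h2
    simpa using h2
  · intro h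
    exact Submodule.span_mono (Set.image_mono (by exact_mod_cast h))

theorem coordSpan_injective (e : Module.Basis S F V) : Function.Injective (coordSpan e) :=
  fun _ _ h => subset_antisymm (coordSpan_le_coordSpan.1 h.le) (coordSpan_le_coordSpan.1 h.ge)

/-- The support of a subspace: the smallest `I` with `U ≤ V_I`. -/
noncomputable def coordSupport [Fintype S] (e : Module.Basis S F V) (U : Submodule F V) :
    Finset S :=
  open Classical in Finset.univ.filter fun i => ∃ u ∈ U, e.repr u i ≠ 0

theorem le_coordSpan_iff [Fintype S] {e : Module.Basis S F V} {U : Submodule F V} {I : Finset S} :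
    U ≤ coordSpan e I ↔ coordSupport e U ⊆ I := by
  classical
  constructor
  · intro h i hi
    obtain ⟨u, hu, hne⟩ := (Finset.mem_filter.1 hi).2
    exact mem_coordSpan.1 (h hu) (Finsupp.mem_support_iff.2 hne)
  · intro h u hu
    exact mem_coordSpan.2 fun i hi =>
      h (Finset.mem_filter.2 ⟨Finset.mem_univ i, u, hu, Finsupp.mem_support_iff.1 hi⟩)

theorem coordSupport_mono [Fintype S] {e : Module.Basis S F V} {U W : Submodule F V}
    (h : U ≤ W) : coordSupport e U ⊆ coordSupport e W :=
  le_coordSpan_iff.1 (h.trans (le_coordSpan_iff.2 subset_rfl))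

theorem coordSupport_coordSpan [Fintype S] (e : Module.Basis S F V) (I : Finset S) :
    coordSupport e (coordSpan e I) = I :=
  subset_antisymm (le_coordSpan_iff.1 le_rfl)
    (coordSpan_le_coordSpan.1 (le_coordSpan_iff.2 subset_rfl))

theorem finrank_le_card_coordSupport [Fintype S] (e : Module.Basis S F V) (U : Submodule F V) :
    Module.finrank F U ≤ (coordSupport e U).card := by
  have : Module.Finite F V := Module.Finite.of_basis e
  rw [← finrank_coordSpan e]
  exact Submodule.finrank_mono (le_coordSpan_iff.2 subset_rfl)

theorem eq_coordSpan_of_card_le [Fintype S] {e : Module.Basis S F V} {U : Submodule F V}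
    {I : Finset S} (h : U ≤ coordSpan e I) (hI : I.card ≤ Module.finrank F U) :
    U = coordSpan e I := by
  have : Module.Finite F V := Module.Finite.of_basis e
  refine Submodule.eq_of_le_of_finrank_le h ?_
  rwa [finrank_coordSpan]

end CoordSpan
/-! ### Regular posets with the standard weights -/

section Regular

variable {P T : Type*} [PartialOrder P] [Fintype P] [Fintype T]

/-- A finite graded poset whose maximal elements are the `τ t`, all of rank `D`, and whose
elements and intervals below maximal elements are counted by functions of the rank alone: an
element of rank `i` covers `a i` elements and is covered by `b i` elements below each maximal
element above it, an interval of length two has `c` atoms, and two elements below `τ t` with a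
common lower cover have exactly one common upper cover below `τ t`. The numbers `a i` and `b i` are
positive where they count something, and `c` is not one. -/
structure IsRegularPoset (r : P → ℕ) (D : ℕ) (a b : ℕ → ℕ) (c : ℕ) (τ : T → P) : Prop where
  covBy_iff : ∀ x y, x ⋖ y ↔ x ≤ y ∧ r y = r x + 1
  rank_mono : Monotone r
  rank_top : ∀ t, r (τ t) = D
  top_injective : Function.Injective τ
  exists_le_top : ∀ x, ∃ t, x ≤ τ t
  numCovered_eq : ∀ z, numCovered z = a (r z)
  ncard_between : ∀ x z, x ≤ z → r z = r x + 2 → {y | x ⋖ y ∧ y ⋖ z}.ncard = c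
  ncard_covBy_le_top : ∀ x t, x ≤ τ t → {y | x ⋖ y ∧ y ≤ τ t}.ncard = b (r x)
  ncard_join : ∀ x y y' t, x ⋖ y → x ⋖ y' → y ≠ y' → y ≤ τ t → y' ≤ τ t →
    {z | (y ⋖ z ∧ y' ⋖ z) ∧ z ≤ τ t}.ncard = 1
  a_pos : ∀ i, 0 < i → 0 < a i
  b_pos : ∀ i, i < D → 0 < b i
  one_lt_c : 1 < c

open Classical in
/-- The total weight of the maximal elements above `x`. -/
noncomputable def topWeight (τ : T → P) (ω : T → ℝ) (x : P) : ℝ :=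
  ∑ t, if x ≤ τ t then ω t else 0

/-- The ratio of the standard weight of an element of rank `i` to the total weight of the maximal
elements above it. -/
noncomputable def rankFactor (D : ℕ) (a b : ℕ → ℕ) (i : ℕ) : ℝ :=
  ∏ j ∈ Finset.Ico i D, ((b j : ℝ) / a (j + 1))

open Classical in
/-- The incidence of the elements covering `x` with the maximal elements. -/
noncomputable def linkInc (τ : T → P) (x y : P) (t : T) : ℝ :=
  if x ⋖ y ∧ y ≤ τ t then 1 else 0

/-- The standard grading, from a rank function that starts at `0`. -/
noncomputable abbrev rankGrading (r : P → ℕ) (w : P → ℝ) : WeightedGrading P :=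
  standardGrading (fun x => (r x : ℤ) - 1) w

theorem linkInc_nonneg (τ : T → P) (x y : P) (t : T) : 0 ≤ linkInc τ x y t := by
  rw [linkInc]; split_ifs <;> norm_num

theorem linkInc_mul_self (τ : T → P) (x y : P) (t : T) :
    linkInc τ x y t * linkInc τ x y t = linkInc τ x y t := by
  rw [linkInc]; split_ifs <;> norm_num

theorem sum_ite_one_eq_ncard {P : Type*} [Fintype P] (p : P → Prop) [DecidablePred p] :
    ∑ y, (if p y then (1 : ℝ) else 0) = ({y | p y}.ncard : ℝ) := by
  classical
  rw [Finset.sum_boole, Set.ncard_eq_toFinset_card']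
  congr 2
  ext; simp

open Classical in
theorem incWeight_linkInc (τ : T → P) (ω : T → ℝ) (x y : P) :
    incWeight ω (linkInc τ x) y = if x ⋖ y then topWeight τ ω y else 0 := by
  simp only [incWeight, linkInc, topWeight, ite_mul, one_mul, zero_mul]
  by_cases h : x ⋖ y <;> simp [h]

theorem link_covBy_iff {x : P} {y z : Link x} : y ⋖ z ↔ y.1 ⋖ z.1 := by
  refine (Set.OrdConnected.apply_covBy_apply_iff (OrderEmbedding.subtype fun c => x ≤ c) ?_).symm
  simpa only [OrderEmbedding.coe_subtype, Subtype.range_coe_subtype] using! Set.ordConnected_Ici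

theorem rankFactor_succ {D : ℕ} {a b : ℕ → ℕ} {i : ℕ} (hi : i < D) :
    rankFactor D a b i = (b i : ℝ) / a (i + 1) * rankFactor D a b (i + 1) := by
  rw [rankFactor, rankFactor, Finset.prod_eq_prod_Ico_succ_bot hi]

namespace IsRegularPoset

variable {r : P → ℕ} {D : ℕ} {a b : ℕ → ℕ} {c : ℕ} {τ : T → P}

theorem rank_le (h : IsRegularPoset r D a b c τ) (x : P) : r x ≤ D := by
  obtain ⟨t, ht⟩ := h.exists_le_top x
  exact h.rank_top t ▸ h.rank_mono ht

theorem isMax_top (h : IsRegularPoset r D a b c τ) (t : T) : IsMax (τ t) := by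
  intro y hy
  by_contra hne
  have hlt : τ t < y := lt_of_le_not_ge hy hne
  obtain ⟨z, hz, -⟩ := exists_covBy_le_of_lt hlt
  have h1 := ((h.covBy_iff _ _).1 hz).2
  have h2 := h.rank_le z
  have h3 := h.rank_top t
  omega

theorem isMax_iff (h : IsRegularPoset r D a b c τ) (x : P) : IsMax x ↔ r x = D := by
  obtain ⟨t, ht⟩ := h.exists_le_top x
  constructor
  · intro hx
    rw [hx.eq_of_le ht, h.rank_top]
  · intro hx
    by_contra hmax
    have hlt : x < τ t := lt_of_le_of_ne ht fun he => hmax (he ▸ h.isMax_top t)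
    obtain ⟨z, hz, -⟩ := exists_covBy_le_of_lt hlt
    have h1 := ((h.covBy_iff _ _).1 hz).2
    have h2 := h.rank_le z
    omega

theorem rankFactor_pos (h : IsRegularPoset r D a b c τ) (i : ℕ) : 0 < rankFactor D a b i := by
  refine Finset.prod_pos fun j hj => ?_
  have h1 := h.b_pos j (Finset.mem_Ico.1 hj).2
  have h2 := h.a_pos (j + 1) (Nat.succ_pos j)
  positivity

theorem topWeight_top (h : IsRegularPoset r D a b c τ) (ω : T → ℝ) (t : T) :
    topWeight τ ω (τ t) = ω t := by
  classical
  rw [topWeight, Finset.sum_eq_single t]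
  · simp
  · intro t' _ hne
    rw [if_neg]
    intro hle
    exact hne (h.top_injective ((h.isMax_top t).eq_of_le hle)).symm
  · simp

theorem topWeight_pos (h : IsRegularPoset r D a b c τ) {ω : T → ℝ} (hω : ∀ t, 0 < ω t) (x : P) :
    0 < topWeight τ ω x := by
  classical
  obtain ⟨t, ht⟩ := h.exists_le_top x
  refine Finset.sum_pos' (fun t _ => ?_) ⟨t, Finset.mem_univ t, by rw [if_pos ht]; exact hω t⟩
  split_ifs
  exacts [(hω t).le, le_rfl]

open Classical in
theorem sum_topWeight (h : IsRegularPoset r D a b c τ) (ω : T → ℝ) (x : P) :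
    ∑ y with x ⋖ y, topWeight τ ω y = b (r x) * topWeight τ ω x := by
  simp only [topWeight]
  rw [Finset.sum_comm, Finset.mul_sum]
  refine Finset.sum_congr rfl fun t _ => ?_
  rw [Finset.sum_filter]
  by_cases hx : x ≤ τ t
  · rw [if_pos hx, ← h.ncard_covBy_le_top x t hx, ← sum_ite_one_eq_ncard, Finset.sum_mul]
    refine Finset.sum_congr rfl fun y _ => ?_
    by_cases h1 : x ⋖ y <;> by_cases h2 : y ≤ τ t <;> simp [h1, h2]
  · rw [if_neg hx, mul_zero]
    refine Finset.sum_eq_zero fun y _ => ?_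
    split_ifs with h1 h2
    exacts [absurd (h1.le.trans h2) hx, rfl, rfl]

/-- The standard weight of an element is a function of its rank times the total weight of the
maximal elements above it. -/
theorem standardWeight_eq (h : IsRegularPoset r D a b c τ) (w : P → ℝ) (x : P) :
    standardWeight w x = rankFactor D a b (r x) * topWeight τ (fun t => w (τ t)) x := by
  classical
  induction x using WellFoundedGT.induction with
  | ind x ih =>
    rw [standardWeight]
    split_ifs with hx
    · obtain ⟨t, ht⟩ := h.exists_le_top x
      obtain rfl := hx.eq_of_le ht
      rw [h.topWeight_top, h.rank_top, rankFactor, Finset.Ico_self, Finset.prod_empty, one_mul]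
    · have hD : r x < D := lt_of_le_of_ne (h.rank_le x) fun he => hx ((h.isMax_iff x).2 he)
      have h1 : ∀ y : {y : P // x ⋖ y}, standardWeight w y.1 / numCovered y.1
          = rankFactor D a b (r x + 1) / a (r x + 1) * topWeight τ (fun t => w (τ t)) y.1 := by
        intro y
        rw [ih y.1 y.2.lt, h.numCovered_eq, ((h.covBy_iff _ _).1 y.2).2]
        ring
      rw [Finset.sum_congr rfl fun y _ => h1 y, ← Finset.mul_sum, rankFactor_succ hD]
      rw [← Finset.sum_subtype (Finset.univ.filter fun y => x ⋖ y) (by simp)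
        (fun y => topWeight τ (fun t => w (τ t)) y), h.sum_topWeight]
      ring

/-- A regular poset with the standard weights is a weighted graded poset as soon as it has a
smallest element, of weight one. -/
theorem isWeightedGraded (h : IsRegularPoset r (D + 1) a b c τ) (w : P → ℝ)
    (hw : ∀ t, 0 < w (τ t)) (o : P) (ho : ∀ x, r x = 0 ↔ x = o)
    (hwo : standardWeight w o = 1) :
    (rankGrading r w).IsWeightedGraded D where
  rk_ge x := by
    simp only [standardGrading]
    omega
  rk_mono x y hxy := by
    have := h.rank_mono hxy
    simp only [standardGrading]
    omega
  rk_covBy x y hxy := by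
    have := ((h.covBy_iff _ _).1 hxy).2
    simp only [standardGrading]
    omega
  existsUnique_bot := by
    refine ⟨o, ?_, fun x hx => ?_⟩
    · have := (ho o).2 rfl
      simp [standardGrading, this]
    · refine (ho x).1 ?_
      simp only [standardGrading] at hx
      omega
  rk_le x := by
    have := h.rank_le x
    simp only [standardGrading]
    omega
  pure x := by
    obtain ⟨t, ht⟩ := h.exists_le_top x
    refine ⟨τ t, ht, ?_⟩
    simp [standardGrading, h.rank_top]
  m_pos x := by
    simp only [standardGrading]
    rw [h.standardWeight_eq]
    exact mul_pos (h.rankFactor_pos _) (h.topWeight_pos hw x)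
  p_nonneg z y := by
    simp only [standardGrading]
    split_ifs <;> positivity
  p_pos_iff z y := by
    simp only [standardGrading]
    split_ifs with hy
    · have h1 := ((h.covBy_iff _ _).1 hy).2
      have h2 := h.a_pos (r z) (by omega)
      rw [h.numCovered_eq]
      simp only [hy, iff_true]
      positivity
    · simp [hy]
  p_sum z hz := by
    classical
    have h2 := h.a_pos (r z) (by
      simp only [standardGrading] at hz
      omega)
    have h3 : ∑ y with y ⋖ z, (if y ⋖ z then 1 / (numCovered z : ℝ) else 0)
        = ∑ y, (if y ⋖ z then (1 : ℝ) else 0) * (1 / (numCovered z : ℝ)) := by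
      rw [Finset.sum_filter]
      refine Finset.sum_congr rfl fun y _ => ?_
      split_ifs <;> simp
    simp only [standardGrading]
    convert h3.trans ?_
    rw [← Finset.sum_mul, sum_ite_one_eq_ncard]
    change (numCovered z : ℝ) * _ = 1
    rw [h.numCovered_eq]
    field_simp
  m_eq x hx := by
    classical
    simp only [standardGrading]
    rw [standardWeight, if_neg hx]
    rw [← Finset.sum_subtype (Finset.univ.filter fun y => x ⋖ y) (by simp)
      (fun y => standardWeight w y / numCovered y)]
    refine Finset.sum_congr (by ext; simp) fun y hy => ?_
    rw [if_pos (by simpa using hy)]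
    ring
  m_bot x hx := by
    have : x = o := (ho x).1 (by
      simp only [standardGrading] at hx
      omega)
    rw [this]
    exact hwo

/-! ### Adjacency matrices of links -/

section Link

variable (h : IsRegularPoset r D a b c τ) {w : P → ℝ}

include h in
theorem chainSum_covBy {x y : P} (hxy : x ⋖ y) :
    (rankGrading r w).chainSum y x = 1 / (a (r x + 1) : ℝ) := by
  have h1 := ((h.covBy_iff _ _).1 hxy).2
  have h2 : (((r y : ℤ) - 1) - ((r x : ℤ) - 1)).toNat = 1 := by omega
  simp only [WeightedGrading.chainSum, standardGrading, h2, pow_one, Matrix.of_apply, if_pos hxy,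
    h.numCovered_eq]
  rw [h1]

include h in
theorem chainSum_two {x z : P} (hxz : x ≤ z) (hr : r z = r x + 2) :
    (rankGrading r w).chainSum z x
      = c / ((a (r x + 2) : ℝ) * a (r x + 1)) := by
  classical
  have h2 : (((r z : ℤ) - 1) - ((r x : ℤ) - 1)).toNat = 2 := by omega
  simp only [WeightedGrading.chainSum, standardGrading, h2]
  rw [pow_two, Matrix.mul_apply, ← h.ncard_between x z hxz hr, ← sum_ite_one_eq_ncard,
    Finset.sum_div]
  refine Finset.sum_congr rfl fun y _ => ?_
  simp only [Matrix.of_apply, h.numCovered_eq]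
  by_cases h3 : y ⋖ z <;> by_cases h4 : x ⋖ y
  · have h5 := ((h.covBy_iff _ _).1 h4).2
    simp only [h3, h4, if_true, and_self, h5, hr]
    field_simp
  all_goals simp [h3, h4]

include h in
theorem level_zero_covBy {x : P}
    (y : ((rankGrading r w).link x).Level 0) : x ⋖ y.1.1 := by
  have h1 := y.2
  simp only [WeightedGrading.link, standardGrading] at h1
  exact (h.covBy_iff _ _).2 ⟨y.1.2, by omega⟩

/-- An element covering `x`, as a vertex of the link of `x`. -/
def toLevelZero {x y : P} (hxy : x ⋖ y) :
    ((rankGrading r w).link x).Level 0 :=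
  ⟨⟨y, hxy.le⟩, by
    have h1 := ((h.covBy_iff _ _).1 hxy).2
    simp only [WeightedGrading.link, standardGrading]
    omega⟩

open Classical in
include h in
theorem sum_level_zero {x : P} (g : P → ℝ) :
    ∑ y : ((rankGrading r w).link x).Level 0, g y.1.1
      = ∑ y, if x ⋖ y then g y else 0 := by
  rw [← Finset.sum_filter]
  exact Finset.sum_bij (fun y _ => y.1.1) (fun y _ => by simpa using h.level_zero_covBy y)
    (fun y _ y' _ hy => Subtype.ext (Subtype.ext hy))
    (fun y hy => ⟨h.toLevelZero (by simpa using hy), Finset.mem_univ _, rfl⟩)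
    (fun y _ => rfl)

include h in
theorem link_m_level_zero {x : P} 
    (y : ((rankGrading r w).link x).Level 0) :
    ((rankGrading r w).link x).m y.1
      = rankFactor D a b (r x + 1) / (standardWeight w x * a (r x + 1))
        * topWeight τ (fun t => w (τ t)) y.1.1 := by
  have hy := h.level_zero_covBy y
  have h1 : ((rankGrading r w).link x).m y.1
      = standardWeight w y.1.1 / standardWeight w x
        * (rankGrading r w).chainSum y.1.1 x := rfl
  rw [h1, h.chainSum_covBy hy, h.standardWeight_eq w y.1.1, ((h.covBy_iff _ _).1 hy).2]
  ring

open Classical in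
include h in
theorem adjMatrix_apply {x : P} (hw : ∀ t, 0 < w (τ t)) (hx : r x + 2 ≤ D)
    (y y' : ((rankGrading r w).link x).Level 0) (hne : y' ≠ y) :
    ((rankGrading r w).link x).adjMatrix 0 y y'
      = (∑ z with y'.1.1 ⋖ z ∧ y.1.1 ⋖ z, topWeight τ (fun t => w (τ t)) z)
        / (((c : ℝ) - 1) * b (r x + 1) * topWeight τ (fun t => w (τ t)) y.1.1) := by
  set M := topWeight τ (fun t => w (τ t)) with hM
  have hy := h.level_zero_covBy y
  have hy' := h.level_zero_covBy y'
  have hM0 : ∀ x, 0 < M x := h.topWeight_pos hw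
  have hmx : 0 < standardWeight w x := by
    rw [h.standardWeight_eq]; exact mul_pos (h.rankFactor_pos _) (hM0 x)
  have ha1 : (0 : ℝ) < a (r x + 1) := by exact_mod_cast h.a_pos _ (Nat.succ_pos _)
  have ha2 : (0 : ℝ) < a (r x + 2) := by exact_mod_cast h.a_pos _ (Nat.succ_pos _)
  have hb1 : (0 : ℝ) < b (r x + 1) := by exact_mod_cast h.b_pos _ (by omega)
  have hc : (1 : ℝ) < c := by exact_mod_cast h.one_lt_c
  have hK := h.rankFactor_pos (r x + 2)
  have hMy := hM0 y.1.1
  have hp : ∀ (z : Link x) (y : ((rankGrading r w).link x).Level 0), y.1.1 ⋖ z.1 →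
      ((rankGrading r w).link x).p z y.1 = 1 / c := by
    intro z y hz
    have hy := h.level_zero_covBy y
    have hr1 := ((h.covBy_iff _ _).1 hy).2
    have hrz := ((h.covBy_iff _ _).1 hz).2
    have h1 : ((rankGrading r w).link x).p z y.1
        = (if y.1.1 ⋖ z.1 then 1 / (numCovered z.1 : ℝ) else 0)
          * (rankGrading r w).chainSum y.1.1 x / (rankGrading r w).chainSum z.1 x := rfl
    have hrz' : r z.1 = r x + 2 := by omega
    rw [h1, if_pos hz, h.chainSum_covBy hy, h.chainSum_two z.2 hrz', h.numCovered_eq, hrz']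
    field_simp
  have hterm : ∀ z : Link x, y'.1 ⋖ z ∧ y.1 ⋖ z →
      ((rankGrading r w).link x).m z * ((rankGrading r w).link x).p z y'.1 * ((rankGrading r w).link x).p z y.1
        / ((1 - ((rankGrading r w).link x).p z y.1) * ((rankGrading r w).link x).m y.1)
      = M z.1 / (((c : ℝ) - 1) * b (r x + 1) * M y.1.1) := by
    rintro z ⟨hz', hz⟩
    rw [link_covBy_iff] at hz hz'
    have hr1 := ((h.covBy_iff _ _).1 hy).2
    have hrz := ((h.covBy_iff _ _).1 hz).2
    have hrz' : r z.1 = r x + 2 := by omega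
    have h1 : ((rankGrading r w).link x).m z
        = standardWeight w z.1 / standardWeight w x * (rankGrading r w).chainSum z.1 x := rfl
    rw [hp z y hz, hp z y' hz', h.link_m_level_zero y, h1, h.chainSum_two z.2 hrz',
      h.standardWeight_eq w z.1, hrz', rankFactor_succ (show r x + 1 < D by omega)]
    have hc1 : (c : ℝ) - 1 ≠ 0 := by linarith
    have hc2 : (1 : ℝ) - 1 / c ≠ 0 := by
      have : (1 : ℝ) / c < 1 := by rw [div_lt_one (by linarith)]; exact hc
      linarith
    have e1 : (1 : ℝ) - 1 / c = (c - 1) / c := by field_simp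
    rw [e1]
    have hc0 : (c : ℝ) ≠ 0 := by linarith
    rw [← hM]
    field_simp
  rw [WeightedGrading.adjMatrix, Matrix.of_apply, if_neg hne, Finset.sum_div]
  refine Finset.sum_bij (fun z _ => z.1) ?_ (fun z _ z' _ hz => Subtype.ext hz) ?_ ?_
  · intro z hz
    have hz := (Finset.mem_filter.1 hz).2
    rw [link_covBy_iff, link_covBy_iff] at hz
    simpa using hz
  · intro z hz
    have hz := (Finset.mem_filter.1 hz).2
    refine ⟨⟨z, hy.le.trans hz.2.le⟩, ?_, rfl⟩
    rw [Finset.mem_filter, link_covBy_iff, link_covBy_iff]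
    exact ⟨Finset.mem_univ _, hz⟩
  · intro z hz
    exact hterm z (Finset.mem_filter.1 hz).2

open Classical in
include h in
theorem sum_topWeight_join {x y y' : P} (hy : x ⋖ y) (hy' : x ⋖ y') (hne : y' ≠ y) (ω : T → ℝ) :
    ∑ z with y' ⋖ z ∧ y ⋖ z, topWeight τ ω z
      = ∑ t, ω t * (linkInc τ x y' t * linkInc τ x y t) := by
  simp only [topWeight]
  rw [Finset.sum_comm]
  refine Finset.sum_congr rfl fun t _ => ?_
  rw [Finset.sum_filter]
  by_cases ht : y' ≤ τ t ∧ y ≤ τ t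
  · have h1 := h.ncard_join x y' y t hy' hy hne ht.1 ht.2
    have h2 : ∑ z, (if (y' ⋖ z ∧ y ⋖ z) ∧ z ≤ τ t then (1 : ℝ) else 0) = 1 := by
      rw [sum_ite_one_eq_ncard, h1, Nat.cast_one]
    have h3 : linkInc τ x y' t * linkInc τ x y t = 1 := by
      simp [linkInc, hy, hy', ht.1, ht.2]
    rw [h3, ← h2, Finset.mul_sum]
    refine Finset.sum_congr rfl fun z _ => ?_
    by_cases h3 : y' ⋖ z ∧ y ⋖ z <;> by_cases h4 : z ≤ τ t <;> simp [h3, h4]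
  · have h2 : linkInc τ x y' t * linkInc τ x y t = 0 := by
      simp only [linkInc, hy, hy', true_and]
      rcases not_and_or.1 ht with h3 | h3 <;> simp [h3]
    rw [h2, mul_zero]
    refine Finset.sum_eq_zero fun z _ => ?_
    split_ifs with h3 h4
    · exact absurd ⟨h3.1.le.trans h4, h3.2.le.trans h4⟩ ht
    · rfl
    · rfl

include h in
/-- The adjacency matrix of a link in terms of the walk to a maximal element and back. -/
theorem sum_linkInc_mul_incSum {x : P} (hw : ∀ t, 0 < w (τ t)) (hx : r x + 2 ≤ D) (f : P → ℝ)
    (y : ((rankGrading r w).link x).Level 0) :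
    ∑ t, linkInc τ x y.1.1 t * w (τ t) * incSum (linkInc τ x) f t
      = topWeight τ (fun t => w (τ t)) y.1.1 * (f y.1.1 + ((c : ℝ) - 1) * b (r x + 1)
        * (((rankGrading r w).link x).adjMatrix 0).mulVec
          (fun y => f y.1.1) y) := by
  classical
  have hy := h.level_zero_covBy y
  set M := topWeight τ (fun t => w (τ t)) with hM
  have hM0 := h.topWeight_pos hw y.1.1
  rw [← hM] at hM0
  have hb1 : (0 : ℝ) < b (r x + 1) := by exact_mod_cast h.b_pos _ (by omega)
  have hc : (1 : ℝ) < c := by exact_mod_cast h.one_lt_c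
  have hc1 : (c : ℝ) - 1 ≠ 0 := by linarith
  have h1 : ∀ y' : ((rankGrading r w).link x).Level 0,
      M y.1.1 * (((c : ℝ) - 1) * b (r x + 1)) * (((rankGrading r w).link x).adjMatrix 0 y y' * f y'.1.1)
        + (if y' = y then M y.1.1 * f y.1.1 else 0)
      = ∑ t, linkInc τ x y.1.1 t * w (τ t) * (linkInc τ x y'.1.1 t * f y'.1.1) := by
    intro y'
    by_cases hyy : y' = y
    · subst hyy
      have h2 : ((rankGrading r w).link x).adjMatrix 0 y' y' = 0 := by
        rw [WeightedGrading.adjMatrix, Matrix.of_apply, if_pos rfl]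
      rw [if_pos rfl, h2, zero_mul, mul_zero, zero_add, hM]
      have h3 := incWeight_linkInc τ (fun t => w (τ t)) x y'.1.1
      rw [if_pos hy] at h3
      rw [← h3, incWeight, Finset.sum_mul]
      refine Finset.sum_congr rfl fun t _ => ?_
      have := linkInc_mul_self τ x y'.1.1 t
      linear_combination (-w (τ t) * f y'.1.1) * this
    · rw [if_neg hyy, h.adjMatrix_apply hw hx y y' hyy,
        h.sum_topWeight_join hy (h.level_zero_covBy y') fun h0 =>
          hyy (Subtype.ext (Subtype.ext h0)), ← hM, add_zero]
      rw [show ∀ s : ℝ, M y.1.1 * (((c : ℝ) - 1) * b (r x + 1))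
          * (s / (((c : ℝ) - 1) * b (r x + 1) * M y.1.1) * f y'.1.1) = s * f y'.1.1 from
        fun s => by field_simp, Finset.sum_mul]
      exact Finset.sum_congr rfl fun t _ => by ring
  have h4 : M y.1.1 * (f y.1.1 + ((c : ℝ) - 1) * b (r x + 1)
      * (((rankGrading r w).link x).adjMatrix 0).mulVec (fun y => f y.1.1) y)
      = ∑ y' : ((rankGrading r w).link x).Level 0,
        ∑ t, linkInc τ x y.1.1 t * w (τ t) * (linkInc τ x y'.1.1 t * f y'.1.1) := by
    rw [← Finset.sum_congr rfl fun y' _ => h1 y', Finset.sum_add_distrib, Finset.sum_ite_eq',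
      if_pos (Finset.mem_univ y), ← Finset.mul_sum]
    simp only [Matrix.mulVec, dotProduct]
    ring
  rw [h4, Finset.sum_comm]
  refine Finset.sum_congr rfl fun t _ => ?_
  rw [← Finset.mul_sum]
  congr 1
  rw [h.sum_level_zero (fun y' => linkInc τ x y' t * f y'), incSum]
  refine Finset.sum_congr rfl fun y' _ => ?_
  by_cases h5 : x ⋖ y'
  · rw [if_pos h5]
  · rw [if_neg h5, linkInc, if_neg (fun h6 => h5 h6.1), zero_mul]

include h in
theorem exists_incEigen_of_isEigenvalue {x : P} (hw : ∀ t, 0 < w (τ t)) (hx : r x + 2 ≤ D)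
    {v : ((rankGrading r w).link x).Level 0 → ℝ} (hv : v ≠ 0) {l : ℝ}
    (hl : (((rankGrading r w).link x).adjMatrix 0).mulVec v = l • v) :
    ∃ f : P → ℝ, (∀ y, v y = f y.1.1) ∧
      (∃ y, incWeight (fun t => w (τ t)) (linkInc τ x) y ≠ 0 ∧ f y ≠ 0) ∧
      IncEigen (fun t => w (τ t)) (linkInc τ x) (1 + l * (((c : ℝ) - 1) * b (r x + 1))) f := by
  classical
  let f : P → ℝ := fun y => if hy : x ⋖ y then v (h.toLevelZero hy) else 0
  have hf : ∀ y, v y = f y.1.1 := fun y => by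
    simp only [f, dif_pos (h.level_zero_covBy y)]
    rfl
  refine ⟨f, hf, ?_, ?_⟩
  · obtain ⟨y, hy⟩ := Function.ne_iff.1 hv
    refine ⟨y.1.1, ?_, by rw [← hf]; exact hy⟩
    rw [incWeight_linkInc, if_pos (h.level_zero_covBy y)]
    exact (h.topWeight_pos hw _).ne'
  · intro y
    rw [incWeight_linkInc]
    by_cases hy : x ⋖ y
    · have h1 := h.sum_linkInc_mul_incSum hw hx f (h.toLevelZero hy)
      have h2 : (fun y : ((rankGrading r w).link x).Level 0 =>
        f y.1.1) = v := funext fun y => (hf y).symm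
      rw [h2, hl, Pi.smul_apply, hf, smul_eq_mul] at h1
      rw [if_pos hy]
      refine h1.trans ?_
      change topWeight _ _ y * (f y + _ * (l * f y)) = _
      ring
    · rw [if_neg hy]
      have : ∀ t, linkInc τ x y t = 0 := fun t => by rw [linkInc, if_neg (fun h6 => hy h6.1)]
      simp [this]

open Classical in
include h in
theorem sum_link_m_mul {x : P} (f : P → ℝ) :
    ∑ y : ((rankGrading r w).link x).Level 0,
      ((rankGrading r w).link x).m y.1 * f y.1.1
      = rankFactor D a b (r x + 1) / (standardWeight w x * a (r x + 1))
        * ∑ y, incWeight (fun t => w (τ t)) (linkInc τ x) y * f y := by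
  have h1 : ∀ y : ((rankGrading r w).link x).Level 0,
      ((rankGrading r w).link x).m y.1 * f y.1.1
      = rankFactor D a b (r x + 1) / (standardWeight w x * a (r x + 1))
        * (topWeight τ (fun t => w (τ t)) y.1.1 * f y.1.1) := fun y => by
    rw [h.link_m_level_zero y]; ring
  rw [Finset.sum_congr rfl fun y _ => h1 y, ← Finset.mul_sum,
    h.sum_level_zero fun y => topWeight τ (fun t => w (τ t)) y * f y]
  congr 1
  refine Finset.sum_congr rfl fun y _ => ?_
  rw [incWeight_linkInc]
  split_ifs <;> simp

include h in
theorem isNontrivialEigenvalue_le {x : P} (hw : ∀ t, 0 < w (τ t)) (hx : r x + 2 ≤ D) {β : ℝ}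
    (hβ : IncEigenBound (fun t => w (τ t)) (linkInc τ x) β) {l : ℝ}
    (hl : ((rankGrading r w).link x).IsNontrivialEigenvalue l) :
    1 + l * (((c : ℝ) - 1) * b (r x + 1)) ≤ β := by
  obtain ⟨v, hv, hsum, hA⟩ := hl
  obtain ⟨f, hf, hne, heig⟩ := h.exists_incEigen_of_isEigenvalue hw hx hv hA
  refine hβ f _ hne ?_ heig
  rw [Finset.sum_congr rfl fun y _ => by rw [hf y], h.sum_link_m_mul] at hsum
  refine (mul_eq_zero.1 hsum).resolve_left (ne_of_gt ?_)
  have ha1 : (0 : ℝ) < a (r x + 1) := by exact_mod_cast h.a_pos _ (Nat.succ_pos _)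
  have hmx : 0 < standardWeight w x := by
    rw [h.standardWeight_eq]; exact mul_pos (h.rankFactor_pos _) (h.topWeight_pos hw x)
  exact div_pos (h.rankFactor_pos _) (mul_pos hmx ha1)

include h in
theorem isEigenvalue_ge {x : P} (hw : ∀ t, 0 < w (τ t)) (hx : r x + 2 ≤ D) {l : ℝ}
    (hl : ((rankGrading r w).link x).IsEigenvalue l) :
    0 ≤ 1 + l * (((c : ℝ) - 1) * b (r x + 1)) := by
  obtain ⟨v, hv, hA⟩ := hl
  obtain ⟨f, -, hne, heig⟩ := h.exists_incEigen_of_isEigenvalue hw hx hv hA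
  exact heig.nonneg (fun t => (hw t).le) (fun y t => linkInc_nonneg τ x y t) hne

include h in
/-- A bound on the non-trivial eigenvalues of the adjacency matrix of a link bounds those of the
walk to a maximal element and back. -/
theorem incEigenBound_of_isNontrivialEigenvalue {x : P} (hw : ∀ t, 0 < w (τ t))
    (hx : r x + 2 ≤ D) {ε : ℝ}
    (hε : ∀ l, ((rankGrading r w).link x).IsNontrivialEigenvalue l →
      l ≤ ε) :
    IncEigenBound (fun t => w (τ t)) (linkInc τ x) (1 + ε * (((c : ℝ) - 1) * b (r x + 1))) := by
  classical
  intro f β ⟨y₀, hy₀, hfy₀⟩ hsum heig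
  have hb1 : (0 : ℝ) < b (r x + 1) := by exact_mod_cast h.b_pos _ (by omega)
  have hc : (1 : ℝ) < c := by exact_mod_cast h.one_lt_c
  have hk : 0 < ((c : ℝ) - 1) * b (r x + 1) := mul_pos (by linarith) hb1
  have h1 : (β - 1) / (((c : ℝ) - 1) * b (r x + 1)) ≤ ε := by
    refine hε _ ⟨fun y => f y.1.1, ?_, ?_, ?_⟩
    · intro h0
      have hcov : x ⋖ y₀ := by
        by_contra hn
        rw [incWeight_linkInc, if_neg hn] at hy₀
        exact hy₀ rfl
      exact hfy₀ (congrFun h0 (h.toLevelZero hcov))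
    · rw [h.sum_link_m_mul, hsum, mul_zero]
    · funext y
      have h2 := h.sum_linkInc_mul_incSum hw hx f y
      rw [heig, incWeight_linkInc, if_pos (h.level_zero_covBy y)] at h2
      have hM := h.topWeight_pos hw y.1.1
      rw [mul_left_comm] at h2
      have h3 := mul_left_cancel₀ hM.ne' h2
      rw [Pi.smul_apply, smul_eq_mul, div_mul_eq_mul_div, eq_div_iff hk.ne']
      linear_combination -h3
  rw [div_le_iff₀ hk] at h1
  linarith

end Link

/-! ### Trickling down -/

section Trickle

variable (h : IsRegularPoset r D a b c τ) {ω : T → ℝ}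

include h in
theorem sum_linkInc {x : P} {t : T} (hx : x ≤ τ t) : ∑ y, linkInc τ x y t = b (r x) := by
  classical
  simp only [linkInc]
  rw [sum_ite_one_eq_ncard, h.ncard_covBy_le_top x t hx]

include h in
theorem linkInc_mul_sum (x y : P) (t : T) :
    linkInc τ x y t * ∑ y', linkInc τ x y' t = linkInc τ x y t * b (r x) := by
  by_cases hy : x ⋖ y ∧ y ≤ τ t
  · rw [h.sum_linkInc (hy.1.le.trans hy.2)]
  · rw [linkInc, if_neg hy, zero_mul, zero_mul]

include h in
/-- Trickling down in a regular poset: bounds on the links of the elements covering `x` give a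
bound on the link of `x`, provided that it is connected. -/
theorem incEigenBound_trickle (hω : ∀ t, 0 < ω t) {x : P} (hx : r x + 2 ≤ D)
    (hb : b (r x) = (c - 1) * b (r x + 1) + 1) {β' : ℝ} (hβ0 : 0 ≤ β')
    (hlt : β' < b (r x + 1))
    (hloc : ∀ y, x ⋖ y → IncEigenBound ω (linkInc τ y) β')
    (hconn : ∀ f : P → ℝ, (∀ y y' t, x ⋖ y → x ⋖ y' → y ≤ τ t → y' ≤ τ t → f y = f y') →
      ∀ y y', x ⋖ y → x ⋖ y' → f y = f y') :
    IncEigenBound ω (linkInc τ x)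
      (β' * ((b (r x + 1) : ℝ) - 1) / ((b (r x + 1) : ℝ) - β')) := by
  classical
  intro f β hf hsum heig
  have hw0 : ∀ t, 0 ≤ ω t := fun t => (hω t).le
  have hcov : ∀ {y : P}, incWeight ω (linkInc τ x) y ≠ 0 → x ⋖ y := fun {y} h0 => by
    by_contra hn
    exact h0 (by rw [incWeight_linkInc, if_neg hn])
  have hbN : β < b (r x) := by
    refine heig.lt_of_connected (N := b (r x)) (by exact_mod_cast h.b_pos _ (by omega)) hw0
      (linkInc_nonneg τ x) (h.linkInc_mul_sum x) hf hsum fun g hg y y' hy hy' => ?_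
    refine hconn g (fun y y' t h1 h2 h3 h4 => hg y y' t ?_ ?_ (hω t).ne') y y' (hcov hy)
      (hcov hy')
    · rw [linkInc, if_pos ⟨h1, h3⟩]; exact one_ne_zero
    · rw [linkInc, if_pos ⟨h2, h4⟩]; exact one_ne_zero
  have hN'0 : (0 : ℝ) < b (r x + 1) := by exact_mod_cast h.b_pos _ (by omega)
  have hc := h.one_lt_c
  have hNN' : (b (r x) : ℝ) = ((c : ℝ) - 1) * b (r x + 1) + 1 := by
    rw [hb]
    push_cast [Nat.cast_sub hc.le]
    ring
  set Q : P → P → ℝ := fun y z => if x ⋖ y ∧ y ⋖ z then 1 else 0 with hQ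
  set Pz : P → T → ℝ := fun z t => if (x ≤ z ∧ r z = r x + 2) ∧ z ≤ τ t then 1 else 0 with hPz
  have hQP : ∀ y z t, Q y z * Pz z t = if x ⋖ y then linkInc τ y z t else 0 := by
    intro y z t
    simp only [hQ, hPz, linkInc]
    by_cases h1 : x ⋖ y <;> by_cases h2 : y ⋖ z <;> by_cases h3 : z ≤ τ t <;> simp [h1, h2, h3]
    have h4 := ((h.covBy_iff _ _).1 h1).2
    have h5 := ((h.covBy_iff _ _).1 h2).2
    exact ⟨h1.le.trans h2.le, by omega⟩
  have key := heig.trickle (Q := Q) (P := Pz) (N' := b (r x + 1)) (q := (c : ℝ) - 1) (b := β')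
    hN'0 hNN' hw0 (linkInc_nonneg τ x) (linkInc_mul_self τ x)
    (fun y z => by simp only [hQ]; split_ifs <;> norm_num) (h.linkInc_mul_sum x) ?_ ?_ ?_ ?_ hf hbN
  · rw [le_div_iff₀ (by linarith)]
    linarith
  · intro y t
    simp only [hQP]
    by_cases hy : x ⋖ y
    · simp only [hy, if_true]
      simp only [linkInc, hy, true_and]
      rw [sum_ite_one_eq_ncard]
      by_cases hyt : y ≤ τ t
      · rw [h.ncard_covBy_le_top y t hyt, ((h.covBy_iff _ _).1 hy).2, if_pos hyt, mul_one]
      · have : {z | y ⋖ z ∧ z ≤ τ t} = ∅ :=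
          Set.eq_empty_of_forall_notMem fun z hz => hyt (hz.1.le.trans hz.2)
        rw [this, if_neg hyt]
        simp
    · simp [hy, linkInc]
  · intro y y' t hne
    simp only [hQP]
    by_cases hy : x ⋖ y <;> by_cases hy' : x ⋖ y'
    · have h1 : ∀ z, (if x ⋖ y then linkInc τ y z t else 0) * Q y' z
          = if (y ⋖ z ∧ y' ⋖ z) ∧ z ≤ τ t then 1 else 0 := by
        intro z
        simp only [hQ, linkInc, hy, hy', true_and, if_true]
        by_cases h1 : y ⋖ z <;> by_cases h2 : y' ⋖ z <;> by_cases h3 : z ≤ τ t <;>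
          simp [h1, h2, h3]
      rw [Finset.sum_congr rfl fun z _ => h1 z, sum_ite_one_eq_ncard]
      by_cases ht : y ≤ τ t ∧ y' ≤ τ t
      · rw [h.ncard_join x y y' t hy hy' hne ht.1 ht.2]
        simp [linkInc, hy, hy', ht.1, ht.2]
      · have : {z | (y ⋖ z ∧ y' ⋖ z) ∧ z ≤ τ t} = ∅ :=
          Set.eq_empty_of_forall_notMem fun z hz =>
            ht ⟨hz.1.1.le.trans hz.2, hz.1.2.le.trans hz.2⟩
        rw [this]
        rcases not_and_or.1 ht with h3 | h3 <;> simp [linkInc, h3]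
    all_goals simp [hQ, linkInc, hy, hy']
  · intro z t
    simp only [hPz]
    split_ifs with hz
    · simp only [hQ]
      rw [sum_ite_one_eq_ncard, h.ncard_between x z hz.1.1 hz.1.2]
      ring
    · simp
  · intro y g hg
    have h0 : (fun z t => Q y z * Pz z t)
        = fun z t => if x ⋖ y then linkInc τ y z t else 0 := by
      funext z t
      exact hQP y z t
    rw [h0] at hg ⊢
    by_cases hy : x ⋖ y
    · simp only [hy, if_true] at hg ⊢
      exact (hloc y hy).quadratic_le hβ0 hw0 (linkInc_nonneg τ y) (h.linkInc_mul_sum y) g hg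
    · simp [hy, incSum, incWeight]

include h in
/-- The number of covers of `x` below a facet bounds all eigenvalues of the walk. -/
theorem incEigenBound_trivial (hω : ∀ t, 0 < ω t) {x : P} (hx : r x < D) :
    IncEigenBound ω (linkInc τ x) (b (r x)) := by
  classical
  intro f β hf _ heig
  have h1 := sum_mul_sum_sub_sq (h.linkInc_mul_sum x) heig 1 (b (r x))
  have h2 : 0 ≤ ∑ t, ω t * ∑ y, linkInc τ x y t
      * (1 * incSum (linkInc τ x) f t - b (r x) * f y) ^ 2 :=
    Finset.sum_nonneg fun t _ => mul_nonneg (hω t).le (Finset.sum_nonneg fun y _ =>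
      mul_nonneg (linkInc_nonneg τ x y t) (sq_nonneg _))
  rw [h1] at h2
  have h3 := nonneg_of_mul_nonneg_left h2
    (incNormSq_pos (fun t => (hω t).le) (linkInc_nonneg τ x) hf)
  have hb : (0 : ℝ) < b (r x) := by exact_mod_cast h.b_pos _ hx
  nlinarith

end Trickle

end IsRegularPoset
end Regular

/-! ### Lower sets of modular lattices -/

section LowerSet

theorem covBy_and_covBy_iff {L : Type*} [Lattice L] [IsWeakUpperModularLattice L]
    {x y y' z : L} (hy : x ⋖ y) (hy' : x ⋖ y') (hne : y ≠ y') :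
    y ⋖ z ∧ y' ⋖ z ↔ z = y ⊔ y' := by
  have hle : ∀ {y y' : L}, x ⋖ y → x ⋖ y' → y ≠ y' → ¬ y' ≤ y := fun hy hy' hne h =>
    (hy.eq_or_eq hy'.le h).elim (fun h => hy'.ne h.symm) fun h => hne h.symm
  constructor
  · rintro ⟨h, h'⟩
    rcases h.eq_or_eq le_sup_left (sup_le h.le h'.le) with h1 | h1
    · exact absurd (sup_eq_left.1 h1) (hle hy hy' hne)
    · exact h1.symm
  · rintro rfl
    have hinf : y ⊓ y' = x := by
      rcases hy.eq_or_eq (le_inf hy.le hy'.le) inf_le_left with h1 | h1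
      · exact h1
      · exact absurd (inf_eq_left.1 h1) (hle hy' hy hne.symm)
    exact ⟨covBy_sup_of_inf_covBy_of_inf_covBy_left (hinf ▸ hy) (hinf ▸ hy'),
      covBy_sup_of_inf_covBy_of_inf_covBy_right (hinf ▸ hy) (hinf ▸ hy')⟩

theorem subtype_covBy_iff {L : Type*} [PartialOrder L] {p : L → Prop}
    (hp : ∀ x y, x ≤ y → p y → p x) {x y : {x // p x}} : x ⋖ y ↔ x.1 ⋖ y.1 := by
  refine (Set.OrdConnected.apply_covBy_apply_iff (OrderEmbedding.subtype p) ?_).symm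
  refine ⟨?_⟩
  rintro _ ⟨x, rfl⟩ _ ⟨y, rfl⟩ z hz
  exact ⟨⟨z, hp z y.1 hz.2 y.2⟩, rfl⟩

theorem ncard_subtype_eq {L : Type*} {p : L → Prop} (s : Set L) (hs : ∀ x ∈ s, p x) :
    {x : {x // p x} | x.1 ∈ s}.ncard = s.ncard := by
  rw [← Set.ncard_image_of_injective _ Subtype.val_injective]
  congr 1
  ext x
  constructor
  · rintro ⟨y, hy, rfl⟩; exact hy
  · exact fun hx => ⟨⟨x, hs x hx⟩, hx, rfl⟩

/-- A lower set of a modular lattice in which the elements of the intervals are counted by their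
lengths, all of whose maximal elements have rank `D`, is a regular poset. -/
theorem isRegularPoset_lowerSet {L T : Type*} [Lattice L] [IsWeakUpperModularLattice L]
    {p : L → Prop} (hp : ∀ x y, x ≤ y → p y → p x) {r : L → ℕ} {g : ℕ → ℕ} {D : ℕ}
    {τ : T → {x // p x}}
    (hcov : ∀ x y, x ⋖ y ↔ x ≤ y ∧ r y = r x + 1) (hmono : Monotone r)
    (ha : ∀ z, {y | y ⋖ z}.ncard = g (r z))
    (hb : ∀ x z, x ≤ z → {y | x ⋖ y ∧ y ≤ z}.ncard = g (r z - r x))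
    (hg : ∀ i, 0 < i → 0 < g i) (hg2 : 1 < g 2)
    (hτ : ∀ t, r (τ t).1 = D) (hinj : Function.Injective τ) (hle : ∀ x, ∃ t, x ≤ τ t) :
    IsRegularPoset (fun x : {x // p x} => r x.1) D g (fun i => g (D - i)) (g 2) τ where
  covBy_iff x y := by rw [subtype_covBy_iff hp, hcov]; rfl
  rank_mono x y h := hmono h
  rank_top := hτ
  top_injective := hinj
  exists_le_top := hle
  numCovered_eq z := by
    rw [numCovered, ← ha]
    simp only [subtype_covBy_iff hp]
    exact ncard_subtype_eq {y | y ⋖ z.1} fun y hy => hp _ _ (CovBy.le hy) z.2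
  ncard_between x z h hr := by
    have h1 := hb x.1 z.1 h
    rw [show r z.1 - r x.1 = 2 by omega] at h1
    rw [← h1]
    simp only [subtype_covBy_iff hp]
    have h2 : ∀ y : L, x.1 ⋖ y ∧ y ⋖ z.1 ↔ x.1 ⋖ y ∧ y ≤ z.1 := by
      intro y
      refine ⟨fun h => ⟨h.1, h.2.le⟩, fun h => ⟨h.1, (hcov _ _).2 ⟨h.2, ?_⟩⟩⟩
      have := ((hcov _ _).1 h.1).2
      omega
    simp only [h2]
    exact ncard_subtype_eq {y | x.1 ⋖ y ∧ y ≤ z.1} fun y hy => hp _ _ hy.2 z.2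
  ncard_covBy_le_top x t h := by
    rw [← hτ t, ← hb _ _ h]
    simp only [subtype_covBy_iff hp]
    exact ncard_subtype_eq {y | x.1 ⋖ y ∧ y ≤ (τ t).1} fun y hy => hp _ _ hy.2 (τ t).2
  ncard_join x y y' t hy hy' hne hyt hyt' := by
    rw [subtype_covBy_iff hp] at hy hy'
    simp only [subtype_covBy_iff hp]
    have h1 : {z : L | (y.1 ⋖ z ∧ y'.1 ⋖ z) ∧ z ≤ (τ t).1} = {y.1 ⊔ y'.1} := by
      ext z
      rw [Set.mem_ofPred_eq, covBy_and_covBy_iff hy hy' (fun h => hne (Subtype.ext h)),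
        Set.mem_singleton_iff]
      refine and_iff_left_of_imp ?_
      rintro rfl
      exact sup_le hyt hyt'
    have h2 := ncard_subtype_eq (p := p) {z : L | (y.1 ⋖ z ∧ y'.1 ⋖ z) ∧ z ≤ (τ t).1}
      fun y hy => hp _ _ hy.2 (τ t).2
    rw [h1, Set.ncard_singleton, ← h1] at h2
    exact h2
  a_pos := hg
  b_pos i hi := hg _ (by omega)
  one_lt_c := hg2

theorem rankFactor_zero {g : ℕ → ℕ} (hg : ∀ i, 0 < i → 0 < g i) (D : ℕ) :
    rankFactor D g (fun i => g (D - i)) 0 = 1 := by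
  rw [rankFactor, Nat.Ico_zero_eq_range, Finset.prod_div_distrib]
  have h1 : ∏ j ∈ Finset.range D, (g (D - j) : ℝ) = ∏ j ∈ Finset.range D, (g (j + 1) : ℝ) := by
    rw [← Finset.prod_range_reflect]
    refine Finset.prod_congr rfl fun j hj => ?_
    have := Finset.mem_range.1 hj
    rw [show D - (D - 1 - j) = j + 1 by omega]
  rw [h1]
  refine div_self (Finset.prod_ne_zero_iff.2 fun j _ => ?_)
  have := hg (j + 1) (Nat.succ_pos j)
  positivity

end LowerSet

/-! ### Connected links -/

section Connected

variable {P T : Type*} [PartialOrder P] [Fintype P] {r : P → ℕ} {D : ℕ} {a b : ℕ → ℕ}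
  {c : ℕ} {τ : T → P}

/-- A function on the vertices of a connected link that agrees on adjacent vertices is constant. -/
theorem IsRegularPoset.eq_of_isConnected (h : IsRegularPoset r D a b c τ) {w : P → ℝ} {x : P}
    (hx : ((rankGrading r w).link x).IsConnected) {G : P → ℝ}
    (hG : ∀ y y' z, x ⋖ y → x ⋖ y' → y ⋖ z → y' ⋖ z → G y = G y') {y y' : P}
    (hy : x ⋖ y) (hy' : x ⋖ y') : G y = G y' := by
  classical
  obtain ⟨j, -, hj⟩ := hx (h.toLevelZero (w := w) hy).1 (h.toLevelZero (w := w) hy').1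
    (h.toLevelZero hy).2 (h.toLevelZero hy').2
  have key : ∀ (j : ℕ) (z : Link x),
      ((((rankGrading r w).link x).upperWalk ^ j) (Pi.single (h.toLevelZero (w := w) hy).1 1)) z
        ≠ 0 → x ⋖ z.1 ∧ G y = G z.1 := by
    intro j
    induction j with
    | zero =>
      intro z hz
      rw [pow_zero, Module.End.one_apply] at hz
      by_cases hzy : z = (h.toLevelZero (w := w) hy).1
      · rw [hzy]; exact ⟨hy, rfl⟩
      · rw [Pi.single_eq_of_ne hzy] at hz
        exact absurd rfl hz
    | succ j ih =>
      intro z hz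
      rw [pow_succ', Module.End.mul_apply] at hz
      obtain ⟨u, hu, hu0⟩ := Finset.exists_ne_zero_of_sum_ne_zero hz
      obtain ⟨z', hz', hz0⟩ := Finset.exists_ne_zero_of_sum_ne_zero (right_ne_zero_of_mul hu0)
      have hzu := link_covBy_iff.1 (Finset.mem_filter.1 hu).2
      have hzu' := link_covBy_iff.1 (Finset.mem_filter.1 hz').2
      obtain ⟨h1, h2⟩ := ih z' (right_ne_zero_of_mul hz0)
      have h3 := ((h.covBy_iff _ _).1 hzu).2
      have h4 := ((h.covBy_iff _ _).1 hzu').2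
      have h5 := ((h.covBy_iff _ _).1 h1).2
      have h6 : x ⋖ z.1 := (h.covBy_iff _ _).2 ⟨z.2, by omega⟩
      exact ⟨h6, h2.trans (hG _ _ u.1 h1 h6 hzu' hzu)⟩
  exact (key j _ (by convert hj)).2

end Connected

/-! ### Simplicial complexes and their Grassmannian posetifications -/

section Instances

/-- The faces of dimension `d`. -/
abbrev Facet {S : Type*} (X : Finset (Finset S)) (d : ℕ) : Type _ := {t : X // t.1.card = d + 1}

theorem finset_covBy_iff_card {S : Type*} {s t : Finset S} :
    s ⋖ t ↔ s ≤ t ∧ t.card = s.card + 1 := by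
  classical
  rw [Finset.covBy_iff_card_sdiff_eq_one]
  refine and_congr_right fun h => ?_
  have h1 := Finset.card_sdiff_of_subset h
  have h2 := Finset.card_le_card h
  omega

theorem finset_ncard_covBy {S : Type*} (z : Finset S) : {y | y ⋖ z}.ncard = z.card := by
  classical
  have : {y | y ⋖ z} = z.erase '' (z : Set S) := by
    ext y
    simp [Finset.covBy_iff_exists_erase]
  rw [this, Set.InjOn.ncard_image, Set.ncard_coe_finset]
  exact z.erase_injOn

theorem finset_ncard_covBy_and_le {S : Type*} {x z : Finset S} (h : x ≤ z) :
    {y | x ⋖ y ∧ y ≤ z}.ncard = z.card - x.card := by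
  classical
  have : {y | x ⋖ y ∧ y ≤ z} = (fun i => insert i x) '' ((z \ x : Finset S) : Set S) := by
    ext y
    simp only [Finset.covBy_iff_exists_insert, Set.mem_ofPred_eq, Set.mem_image, Finset.mem_coe,
      Finset.mem_sdiff]
    constructor
    · rintro ⟨⟨i, hi, rfl⟩, hz⟩
      exact ⟨i, ⟨hz (Finset.mem_insert_self i x), hi⟩, rfl⟩
    · rintro ⟨i, ⟨hz, hi⟩, rfl⟩
      exact ⟨⟨i, hi, rfl⟩, Finset.insert_subset hz h⟩
  rw [this, Set.InjOn.ncard_image, Set.ncard_coe_finset, Finset.card_sdiff_of_subset h]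
  intro i hi j hj hij
  exact (Finset.insert_inj (Finset.mem_sdiff.1 hi).2).1 hij

theorem isRegularPoset_complex {S : Type*} {X : Finset (Finset S)} (hX : IsSimplicialComplex X)
    {d : ℕ} (hpure : ∀ s : X, ∃ t : Facet X d, s ≤ t.1) :
    IsRegularPoset (fun s : X => s.1.card) (d + 1) (fun i => i) (fun i => d + 1 - i) 2
      (Subtype.val : Facet X d → X) := by
  classical
  exact isRegularPoset_lowerSet (g := fun i => i) (fun s t hst ht => hX.down_closed t ht s hst)
    (fun _ _ => finset_covBy_iff_card) Finset.card_mono finset_ncard_covBy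
    (fun _ _ => finset_ncard_covBy_and_le) (fun _ h => h) (by norm_num) (fun t => t.2)
    Subtype.val_injective hpure

variable {S F V : Type*} [Fintype S] [Field F] [Fintype F] [AddCommGroup V] [Module F V]

/-- The coordinate subspace of a face, as an element of the posetification. -/
def coordFace (e : Module.Basis S F V) {X : Finset (Finset S)} (s : X) :
    grassmannianPosetification e X :=
  ⟨coordSpan e s.1, s.1, s.2, le_rfl⟩

theorem coordFace_le_iff {e : Module.Basis S F V} {X : Finset (Finset S)} {s t : X} :
    coordFace e s ≤ coordFace e t ↔ s ≤ t :=
  coordSpan_le_coordSpan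

theorem coordFace_injective (e : Module.Basis S F V) (X : Finset (Finset S)) :
    Function.Injective (coordFace e : X → grassmannianPosetification e X) := fun _ _ h =>
  Subtype.ext (coordSpan_injective e (congrArg Subtype.val h))

theorem le_coordFace_iff {e : Module.Basis S F V} {X : Finset (Finset S)}
    {y : grassmannianPosetification e X} {s : X} :
    y ≤ coordFace e s ↔ coordSupport e y.1 ⊆ s.1 :=
  le_coordSpan_iff

theorem finrank_coordFace (e : Module.Basis S F V) {X : Finset (Finset S)} (s : X) :
    Module.finrank F (coordFace e s).1 = s.1.card :=
  finrank_coordSpan e s.1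

theorem coordSupport_mem {e : Module.Basis S F V} {X : Finset (Finset S)}
    (hX : IsSimplicialComplex X) (y : grassmannianPosetification e X) :
    coordSupport e y.1 ∈ X := by
  obtain ⟨I, hI, hy⟩ := y.2
  exact hX.down_closed I hI _ (le_coordSpan_iff.1 hy)

theorem isRegularPoset_grassmannian (e : Module.Basis S F V) {X : Finset (Finset S)} {d : ℕ}
    (hpure : ∀ s : X, ∃ t : Facet X d, s ≤ t.1) :
    IsRegularPoset (fun y : grassmannianPosetification e X => Module.finrank F y.1) (d + 1)
      (gaussNum (Fintype.card F)) (fun i => gaussNum (Fintype.card F) (d + 1 - i))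
      (gaussNum (Fintype.card F) 2) (fun t : Facet X d => coordFace e t.1) := by
  have : Module.Finite F V := Module.Finite.of_basis e
  refine isRegularPoset_lowerSet (r := fun U : Submodule F V => Module.finrank F U)
    (fun U W hUW ⟨I, hI, hW⟩ => ⟨I, hI, hUW.trans hW⟩) (fun _ _ => submodule_covBy_iff_finrank)
    (fun _ _ => Submodule.finrank_mono) ncard_covBy_left (fun _ _ => ncard_covBy_and_le)
    (fun _ => gaussNum_pos _) ?_ (fun t => ?_) ?_ ?_
  · rw [gaussNum_two]
    have := Fintype.card_pos (α := F)
    omega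
  · exact (finrank_coordFace e t.1).trans t.2
  · exact (coordFace_injective e X).comp Subtype.val_injective
  · rintro ⟨U, I, hI, hU⟩
    obtain ⟨t, ht⟩ := hpure ⟨I, hI⟩
    exact ⟨t, hU.trans (coordSpan_le_coordSpan.2 ht)⟩

open Classical in
theorem sum_ite_coordSpan_eq (e : Module.Basis S F V) {X : Finset (Finset S)} (w : X → ℝ)
    (t : X) : ∑ I : X, (if coordSpan e I.1 = (coordFace e t).1 then w I else 0) = w t := by
  rw [Finset.sum_eq_single t]
  · exact if_pos rfl
  · intro I _ hI
    exact if_neg fun h => hI (Subtype.ext (coordSpan_injective e h))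
  · simp

theorem linkInc_coordFace {e : Module.Basis S F V} {X : Finset (Finset S)}
    (hX : IsSimplicialComplex X) {d : ℕ}
    (hpure : ∀ s : X, ∃ t : Facet X d, s ≤ t.1) (s₀ s : X) (t : Facet X d) :
    linkInc (fun t : Facet X d => coordFace e t.1) (coordFace e s₀) (coordFace e s) t
      = linkInc (Subtype.val : Facet X d → X) s₀ s t := by
  have h1 : coordFace e s₀ ⋖ coordFace e s ↔ s₀ ⋖ s := by
    rw [(isRegularPoset_complex hX hpure).covBy_iff,
      (isRegularPoset_grassmannian e hpure).covBy_iff, coordFace_le_iff, finrank_coordFace,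
      finrank_coordFace]
  have h2 : coordFace e s₀ ⋖ coordFace e s ∧ coordFace e s ≤ coordFace e t.1 ↔ s₀ ⋖ s ∧ s ≤ t.1 :=
    and_congr h1 coordFace_le_iff
  by_cases h3 : s₀ ⋖ s ∧ s ≤ t.1
  · rw [linkInc, linkInc, if_pos h3, if_pos (h2.2 h3)]
  · rw [linkInc, linkInc, if_neg h3, if_neg fun h => h3 (h2.1 h)]

end Instances
section Grassmannian

variable {S F V : Type*} [Fintype S] [Field F] [Fintype F] [AddCommGroup V] [Module F V]
  {e : Module.Basis S F V} {X : Finset (Finset S)} {d : ℕ}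

/-! ### Connectedness of the links of the posetification -/

theorem eq_coordFace_coordSupport {y : grassmannianPosetification e X} {s : X}
    (hs : coordSupport e y.1 = s.1) (hy : s.1.card ≤ Module.finrank F y.1) : y = coordFace e s :=
  Subtype.ext (eq_coordSpan_of_card_le (le_coordSpan_iff.2 hs.le) hy)

/-- The links of the posetification are connected. If `x` is not a coordinate subspace, an element
that covers `x` inside the coordinate subspace of its support lies below all maximal elements
above `x`. If it is the coordinate subspace of a face, every maximal element above `x` is above a
coordinate subspace covering `x`, and those are connected as in the link of the face. -/
theorem grassmannian_link_connected (hX : IsSimplicialComplex X)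
    (hpure : ∀ s : X, ∃ t : Facet X d, s ≤ t.1) {w : X → ℝ}
    (hconn : (complexGrading X w).IsLocallyConnected d) {x : grassmannianPosetification e X}
    (hx : Module.finrank F x.1 + 2 ≤ d + 1) (f : grassmannianPosetification e X → ℝ)
    (hf : ∀ y y' (t : Facet X d), x ⋖ y → x ⋖ y' → y ≤ coordFace e t.1 → y' ≤ coordFace e t.1 →
      f y = f y') {y y' : grassmannianPosetification e X} (hy : x ⋖ y) (hy' : x ⋖ y') :
    f y = f y' := by
  have hV := isRegularPoset_grassmannian e hpure
  have hC := isRegularPoset_complex hX hpure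
  set s₀ : X := ⟨coordSupport e x.1, coordSupport_mem hX x⟩ with hs₀
  have hx₀ : x ≤ coordFace e s₀ := le_coordFace_iff.2 subset_rfl
  have htop : ∀ y, x ⋖ y → ∃ t : Facet X d, y ≤ coordFace e t.1 ∧ s₀ ≤ t.1 := by
    intro y hy
    obtain ⟨t, ht⟩ := hV.exists_le_top y
    exact ⟨t, ht, le_coordFace_iff.1 (hy.le.trans ht)⟩
  rcases hx₀.eq_or_lt with heq | hlt
  · have hcov : ∀ {s : X}, s₀ ⋖ s → x ⋖ coordFace e s := by
      intro s hs
      rw [hC.covBy_iff] at hs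
      rw [heq, hV.covBy_iff, coordFace_le_iff, finrank_coordFace, finrank_coordFace]
      exact hs
    have hcard : s₀.1.card = Module.finrank F x.1 := by rw [← finrank_coordFace e, ← heq]
    have hstep : ∀ y, x ⋖ y → ∃ s : X, s₀ ⋖ s ∧ f y = f (coordFace e s) := by
      intro y hy
      obtain ⟨t, hyt, hst⟩ := htop y hy
      have hlt : s₀ < t.1 := lt_of_le_of_ne hst fun h => by
        have := t.2
        rw [← h] at this
        omega
      obtain ⟨s, hs, hs'⟩ := exists_covBy_le_of_lt hlt
      exact ⟨s, hs, hf _ _ t hy (hcov hs) hyt (coordFace_le_iff.2 hs')⟩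
    obtain ⟨s, hs, hfs⟩ := hstep y hy
    obtain ⟨s', hs', hfs'⟩ := hstep y' hy'
    have hlink : ((rankGrading (fun s : X => s.1.card) w).link s₀).IsConnected := by
      refine hconn s₀ ?_
      change (s₀.1.card : ℤ) - 1 ≤ _
      omega
    rw [hfs, hfs']
    refine hC.eq_of_isConnected hlink (G := fun s => f (coordFace e s)) ?_ hs hs'
    intro s s' z hs hs' hz hz'
    obtain ⟨t, ht⟩ := hpure z
    exact hf _ _ t (hcov hs) (hcov hs') (coordFace_le_iff.2 (hz.le.trans ht))
      (coordFace_le_iff.2 (hz'.le.trans ht))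
  · obtain ⟨u, hu, hu'⟩ := exists_covBy_le_of_lt hlt
    have : ∀ y, x ⋖ y → f y = f u := by
      intro y hy
      obtain ⟨t, hyt, hst⟩ := htop y hy
      exact hf _ _ t hy hu hyt (hu'.trans (coordFace_le_iff.2 hst))
    rw [this y hy, this y' hy']

/-! ### Links of corank two -/

/-- The eigenvalue bound for the links of the elements `x` of rank two less than the maximal one.
Let `F t` be the sum of an eigenvector `f` of eigenvalue `β` over the elements of the link below
the facet `t`. All elements with support `t` have value `F t / β`, so that only the elements with
smaller support matter. There are at most two of them, and if there are two, then `x` is the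
coordinate subspace of a face and the restriction of `f` to coordinate subspaces is an eigenvector
of eigenvalue `β - q + 1` for the link of that face. -/
theorem grassmannian_incEigenBound_corank_two (hX : IsSimplicialComplex X)
    (hpure : ∀ s : X, ∃ t : Facet X d, s ≤ t.1) {ω : Facet X d → ℝ} (hω : ∀ t, 0 < ω t)
    {ε : ℝ} (hε : ∀ s : X, s.1.card + 2 = d + 1 →
      IncEigenBound ω (linkInc (Subtype.val : Facet X d → X) s) (1 + ε))
    {x : grassmannianPosetification e X} (hx : Module.finrank F x.1 + 2 = d + 1) :
    IncEigenBound ω (linkInc (fun t : Facet X d => coordFace e t.1) x)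
      (Fintype.card F + max ε 0) := by
  classical
  have hV := isRegularPoset_grassmannian e hpure
  have hC := isRegularPoset_complex hX hpure
  set q := Fintype.card F with hq
  set τ : Facet X d → grassmannianPosetification e X := fun t => coordFace e t.1 with hτ
  intro f β hf hsum heig
  have hw0 : ∀ t, 0 ≤ ω t := fun t => (hω t).le
  have hε0 : 0 ≤ max ε 0 := le_max_right _ _
  have hq0 : (0 : ℝ) ≤ q := Nat.cast_nonneg q
  rcases le_or_gt β q with hβq | hβq
  · linarith
  have hβ : 0 < β := hq0.trans_lt hβq
  set A := incSum (linkInc τ x) f with hA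
  have hcov1 : ∀ {y t}, linkInc τ x y t ≠ 0 → x ⋖ y ∧ y ≤ τ t := fun {y t} h0 => by
    by_contra hn
    exact h0 (by rw [linkInc, if_neg hn])
  -- the sum over a facet does not vanish identically
  have hA0 : ∃ t, A t ≠ 0 := by
    by_contra! h0
    have h1 := heig.sum_mul_incSum_sq
    rw [← hA] at h1
    simp only [h0] at h1
    have h2 := incNormSq_pos hw0 (linkInc_nonneg τ x) hf
    have h3 := mul_pos hβ h2
    rw [← h1] at h3
    simp at h3
  have hAle : ∀ {t}, A t ≠ 0 → x ≤ τ t := by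
    intro t ht
    obtain ⟨y, -, hy⟩ := Finset.exists_ne_zero_of_sum_ne_zero ht
    have := hcov1 (left_ne_zero_of_mul hy)
    exact this.1.le.trans this.2
  have hωA : ∑ t, ω t * A t = 0 := by
    rw [← hsum, ← sum_mul_sum_incidence]
    rfl
  set s₀ : X := ⟨coordSupport e x.1, coordSupport_mem hX x⟩ with hs₀
  have hx₀ : x ≤ coordFace e s₀ := le_coordFace_iff.2 subset_rfl
  have hxt : ∀ {t : Facet X d}, x ≤ τ t ↔ s₀ ≤ t.1 := fun {t} => le_coordFace_iff
  -- elements with full support in `t`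
  have hfull : ∀ {y t}, x ⋖ y → coordSupport e y.1 = t.1.1 → β * f y = A t := by
    intro y t hy hs
    have hiff : ∀ t', y ≤ τ t' ↔ t' = t := by
      intro t'
      rw [le_coordFace_iff, hs]
      constructor
      · intro h
        refine (Subtype.ext (Subtype.ext (Finset.eq_of_subset_of_card_le h ?_))).symm
        rw [t.2, t'.2]
      · rintro rfl; exact subset_rfl
    have h1 := heig y
    simp only [incWeight, linkInc, hy, true_and, hiff, ite_mul, one_mul, zero_mul,
      Finset.sum_ite_eq', Finset.mem_univ, if_true] at h1
    refine (mul_left_cancel₀ (hω t).ne' (h1.trans ?_)).symm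
    ring
  -- the other elements below `t` are coordinate subspaces
  have hpart : ∀ {y t}, x ⋖ y → y ≤ τ t → coordSupport e y.1 ≠ t.1.1 →
      ∃ s : X, coordSupport e y.1 = s.1 ∧ y = coordFace e s ∧ s.1.card = d := by
    intro y t hy hyt hne
    have h1 := ((hV.covBy_iff _ _).1 hy).2
    have h2 : (coordSupport e y.1).card < t.1.1.card :=
      Finset.card_lt_card (lt_of_le_of_ne (le_coordFace_iff.1 hyt) hne)
    have h3 := finrank_le_card_coordSupport e y.1
    have h4 := t.2
    refine ⟨⟨_, coordSupport_mem hX y⟩, rfl, ?_, by dsimp only; omega⟩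
    refine eq_coordFace_coordSupport rfl ?_
    dsimp only
    omega
  have hcount : ∀ {t}, x ≤ τ t → ∑ y, linkInc τ x y t = q + 1 := by
    intro t ht
    rw [hV.sum_linkInc ht, show d + 1 - Module.finrank F x.1 = 2 by omega, gaussNum_two]
    push_cast
    rfl
  have hsumA : ∀ t, ∑ y, linkInc τ x y t * (β * f y - A t)
      = (β - ∑ y, linkInc τ x y t) * A t := by
    intro t
    have : ∀ y, linkInc τ x y t * (β * f y - A t)
        = β * (linkInc τ x y t * f y) - linkInc τ x y t * A t := fun y => by ring
    rw [Finset.sum_congr rfl fun y _ => this y, Finset.sum_sub_distrib, ← Finset.mul_sum,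
      ← Finset.sum_mul, sub_mul]
    rfl
  have hcard₀ := finrank_le_card_coordSupport e x.1
  have hcard₁ : s₀.1.card ≤ d + 1 := hC.rank_le s₀
  rcases eq_or_lt_of_le hcard₁ with htop | hlt'
  · -- there is only one facet above `x`
    exfalso
    obtain ⟨t, ht⟩ := hA0
    have huniq : ∀ t' : Facet X d, A t' ≠ 0 → t'.1 = s₀ := fun t' ht' =>
      (Subtype.ext (Finset.eq_of_subset_of_card_le (hxt.1 (hAle ht'))
        (by rw [t'.2, htop]))).symm
    rw [Finset.sum_eq_single t] at hωA
    · exact (mul_ne_zero (hω t).ne' ht) hωA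
    · intro t' _ hne
      by_contra h0
      exact hne (Subtype.ext ((huniq t' (right_ne_zero_of_mul h0)).trans (huniq t ht).symm))
    · simp
  rcases lt_or_ge (d - 1) s₀.1.card with hlt | hge
  · -- the only element whose support is not a facet is `coordFace e s₀`, and `f` vanishes there
    exfalso
    have hzero : ∀ {y t}, x ⋖ y → y ≤ τ t → coordSupport e y.1 ≠ t.1.1 → f y = 0 := by
      intro y t hy hyt hne
      obtain ⟨s, hs, hys, hsd⟩ := hpart hy hyt hne
      have hss : s = s₀ := by
        refine Subtype.ext (Finset.eq_of_subset_of_card_le ?_ ?_).symm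
        · exact (coordSupport_mono hy.le).trans hs.le
        · omega
      have hiff : ∀ t', x ⋖ y ∧ y ≤ τ t' ↔ x ≤ τ t' := by
        intro t'
        rw [hxt, hys, hss, hτ, coordFace_le_iff, and_iff_right_iff_imp]
        intro _
        rw [← hss, ← hys]
        exact hy
      have h1 := heig y
      have h2 : ∀ t, linkInc τ x y t * ω t * A t = ω t * A t := by
        intro t
        rw [linkInc]
        split_ifs with h3
        · rw [one_mul]
        · have : A t = 0 := by
            by_contra h4
            exact h3 ((hiff t).2 (hAle h4))
          rw [this]; ring
      rw [← hA, Finset.sum_congr rfl fun t _ => h2 t, hωA, incWeight_linkInc, if_pos hy] at h1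
      have h3 := (mul_eq_zero.1 h1.symm).resolve_left hβ.ne'
      exact (mul_eq_zero.1 h3).resolve_left (hV.topWeight_pos hω y).ne'
    obtain ⟨t, ht⟩ := hA0
    have hterm : ∀ y, linkInc τ x y t * (β * f y - A t) =
        if (x ⋖ y ∧ y ≤ τ t) ∧ coordSupport e y.1 ≠ t.1.1 then -A t else 0 := by
      intro y
      rw [linkInc]
      by_cases h1 : x ⋖ y ∧ y ≤ τ t
      · by_cases h2 : coordSupport e y.1 = t.1.1
        · simp [h1, h2, hfull h1.1 h2]
        · rw [if_pos h1, if_pos ⟨h1, h2⟩, hzero h1.1 h1.2 h2]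
          ring
      · rw [if_neg h1, if_neg fun h => h1 h.1, zero_mul]
    have hcount' : (1 : ℝ)
        ≤ ∑ y, if (x ⋖ y ∧ y ≤ τ t) ∧ coordSupport e y.1 ≠ t.1.1 then 1 else 0 := by
      have hs₀y : coordSupport e (coordFace e s₀).1 = s₀.1 := coordSupport_coordSpan e s₀.1
      have hmem : (x ⋖ coordFace e s₀ ∧ coordFace e s₀ ≤ τ t) ∧
          coordSupport e (coordFace e s₀).1 ≠ t.1.1 := by
        refine ⟨⟨(hV.covBy_iff _ _).2 ⟨hx₀, ?_⟩, coordFace_le_iff.2 (hxt.1 (hAle ht))⟩, ?_⟩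
        · rw [finrank_coordFace]; omega
        · intro h
          have h1 := t.2
          rw [← h, hs₀y] at h1
          omega
      rw [sum_ite_one_eq_ncard]
      exact_mod_cast (Set.ncard_pos (Set.toFinite _)).2 ⟨coordFace e s₀, hmem⟩
    have h1 := hsumA t
    rw [hcount (hAle ht), Finset.sum_congr rfl fun y _ => hterm y] at h1
    have h2 : ∑ y, (if (x ⋖ y ∧ y ≤ τ t) ∧ coordSupport e y.1 ≠ t.1.1 then -A t else 0)
        = -(∑ y, if (x ⋖ y ∧ y ≤ τ t) ∧ coordSupport e y.1 ≠ t.1.1 then (1 : ℝ) else 0)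
          * A t := by
      rw [neg_mul, Finset.sum_mul, ← Finset.sum_neg_distrib]
      refine Finset.sum_congr rfl fun y _ => ?_
      split_ifs <;> ring
    rw [h2] at h1
    have h3 := mul_right_cancel₀ ht h1
    linarith
  · -- `x` is the coordinate subspace of a face
    have hcard : s₀.1.card + 2 = d + 1 := by
      have : s₀.1 = coordSupport e x.1 := rfl
      rw [← this] at hcard₀
      omega
    have hxs : x = coordFace e s₀ := eq_coordFace_coordSupport rfl (by omega)
    set R := linkInc (Subtype.val : Facet X d → X) s₀ with hR
    set g : X → ℝ := fun s => f (coordFace e s) with hg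
    have hinc : ∀ s t, linkInc τ x (coordFace e s) t = R s t := fun s t => by
      rw [hxs]; exact linkInc_coordFace hX hpure s₀ s t
    have hwt : ∀ s, incWeight ω (linkInc τ x) (coordFace e s) = incWeight ω R s := fun s => by
      simp only [incWeight, hinc]
    have hRcount : ∀ {t : Facet X d}, s₀ ≤ t.1 → ∑ s, R s t = 2 := by
      intro t ht
      rw [hR, hC.sum_linkInc ht, show d + 1 - s₀.1.card = 2 by omega]
      norm_num
    -- passing from all elements below `t` to the coordinate subspaces
    have hrestrict : ∀ t, ∑ y, linkInc τ x y t * (β * f y - A t)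
        = ∑ s, R s t * (β * g s - A t) := by
      intro t
      refine (Finset.sum_of_injOn (coordFace e) (coordFace_injective e X).injOn
        (fun _ _ => Finset.mem_coe.2 (Finset.mem_univ _)) ?_ ?_).symm
      · intro y _ hy
        rw [linkInc]
        split_ifs with h1
        · by_cases h2 : coordSupport e y.1 = t.1.1
          · rw [hfull h1.1 h2, sub_self, mul_zero]
          · obtain ⟨s, -, hys, -⟩ := hpart h1.1 h1.2 h2
            exact absurd ⟨s, Finset.mem_coe.2 (Finset.mem_univ _), hys.symm⟩ hy
        · rw [zero_mul]
      · intro s _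
        rw [hinc]
    have hAg : ∀ t, (β - q + 1) * A t = β * incSum R g t := by
      intro t
      have h1 : ∑ s, R s t * (β * g s - A t) = β * incSum R g t - (∑ s, R s t) * A t := by
        rw [incSum, Finset.mul_sum, Finset.sum_mul, ← Finset.sum_sub_distrib]
        exact Finset.sum_congr rfl fun s _ => by ring
      have h2 := (hsumA t).symm.trans ((hrestrict t).trans h1)
      by_cases ht : x ≤ τ t
      · rw [hcount ht, hRcount (hxt.1 ht)] at h2
        linarith
      · have h3 : A t = 0 := by
          by_contra h; exact ht (hAle h)
        rw [h3, mul_zero, mul_zero, sub_zero] at h2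
        rw [h3, mul_zero, ← h2]
    have hAg' : ∀ t, incSum R g t = (β - q + 1) / β * A t := fun t => by
      rw [div_mul_eq_mul_div, hAg, mul_div_cancel_left₀ _ hβ.ne']
    have hbound := hε s₀ hcard g (β - q + 1) ?_ ?_ ?_
    · have := le_max_left ε 0
      linarith
    · by_contra! h0
      obtain ⟨t, ht⟩ := hA0
      have h1 : incSum R g t = 0 := by
        refine Finset.sum_eq_zero fun s _ => ?_
        by_cases hs : incWeight ω R s = 0
        · have h2 := (Finset.sum_eq_zero_iff_of_nonneg fun t _ =>
            mul_nonneg (linkInc_nonneg _ s₀ s t) (hw0 t)).1 hs t (Finset.mem_univ t)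
          rw [hR, (mul_eq_zero.1 h2).resolve_right (hω t).ne', zero_mul]
        · rw [h0 s hs, mul_zero]
      have h2 := hAg t
      rw [h1, mul_zero] at h2
      have h3 := (mul_eq_zero.1 h2).resolve_right ht
      linarith
    · rw [← sum_mul_sum_incidence]
      change ∑ t, ω t * incSum R g t = 0
      have h1 : ∀ t, ω t * incSum R g t = (β - q + 1) / β * (ω t * A t) := fun t => by
        rw [hAg']; ring
      rw [Finset.sum_congr rfl fun t _ => h1 t, ← Finset.mul_sum, hωA, mul_zero]
    · intro s
      have h1 := heig (coordFace e s)
      rw [hwt] at h1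
      simp only [hinc] at h1
      rw [← hA] at h1
      have h2 : ∀ t, R s t * ω t * incSum R g t
          = (β - q + 1) / β * (R s t * ω t * A t) := fun t => by rw [hAg']; ring
      rw [Finset.sum_congr rfl fun t _ => h2 t, ← Finset.mul_sum, h1]
      field_simp
      rfl

/-! ### The eigenvalue bound -/

/-- The bound for the eigenvalues of the walk in the links of corank `j + 2`, obtained by trickling
down from `q + max ε 0` in corank two, or the trivial bound where trickling down gives nothing. -/
noncomputable def spectralBound (q : ℕ) (ε : ℝ) : ℕ → ℝ
  | 0 => q + max ε 0
  | j + 1 =>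
    if spectralBound q ε j < gaussNum q (j + 2) then
      spectralBound q ε j * ((gaussNum q (j + 2) : ℝ) - 1)
        / ((gaussNum q (j + 2) : ℝ) - spectralBound q ε j)
    else gaussNum q (j + 3)

theorem one_le_gaussNum_succ (q n : ℕ) : (1 : ℝ) ≤ gaussNum q (n + 1) := by
  exact_mod_cast gaussNum_pos q (Nat.succ_pos n)

theorem spectralBound_nonneg (q : ℕ) (ε : ℝ) (j : ℕ) : 0 ≤ spectralBound q ε j := by
  induction j with
  | zero => exact add_nonneg (Nat.cast_nonneg q) (le_max_right _ _)
  | succ j ih =>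
    rw [spectralBound]
    split_ifs with h
    · have := one_le_gaussNum_succ q (j + 1)
      exact div_nonneg (mul_nonneg ih (by linarith)) (by linarith)
    · positivity

theorem tendsto_spectralBound (q j : ℕ) :
    Tendsto (fun ε => spectralBound q ε j) (𝓝 0) (𝓝 ((q : ℝ) ^ (j + 1))) := by
  induction j with
  | zero =>
    have : Tendsto (fun ε : ℝ => (q : ℝ) + max ε 0) (𝓝 0) (𝓝 ((q : ℝ) + max 0 0)) :=
      (continuous_const.add (continuous_id.max continuous_const)).tendsto 0
    simpa [spectralBound] using this
  | succ j ih =>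
    have h1 : (gaussNum q (j + 2) : ℝ) = gaussNum q (j + 1) + (q : ℝ) ^ (j + 1) := by
      rw [gaussNum_succ']; push_cast; rfl
    have h2 : (gaussNum q (j + 2) : ℝ) = q * gaussNum q (j + 1) + 1 := by
      rw [gaussNum_succ]; push_cast; rfl
    have h3 := one_le_gaussNum_succ q j
    have hlt : (q : ℝ) ^ (j + 1) < gaussNum q (j + 2) := by linarith
    have h4 : Tendsto (fun ε => spectralBound q ε j * ((gaussNum q (j + 2) : ℝ) - 1)
        / ((gaussNum q (j + 2) : ℝ) - spectralBound q ε j)) (𝓝 0)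
        (𝓝 ((q : ℝ) ^ (j + 1) * ((gaussNum q (j + 2) : ℝ) - 1)
          / ((gaussNum q (j + 2) : ℝ) - (q : ℝ) ^ (j + 1)))) :=
      (ih.mul_const _).div (tendsto_const_nhds.sub ih) (by linarith)
    have h5 : (q : ℝ) ^ (j + 1) * ((gaussNum q (j + 2) : ℝ) - 1)
        / ((gaussNum q (j + 2) : ℝ) - (q : ℝ) ^ (j + 1)) = (q : ℝ) ^ (j + 1 + 1) := by
      rw [div_eq_iff (by linarith)]
      nth_rewrite 1 [h2]
      rw [h1]
      ring
    rw [h5] at h4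
    refine h4.congr' ?_
    filter_upwards [ih.eventually_lt_const hlt] with ε hε
    rw [spectralBound, if_pos hε]

/-- The links of the posetification satisfy the bounds obtained by trickling down. -/
theorem grassmannian_incEigenBound (hX : IsSimplicialComplex X)
    (hpure : ∀ s : X, ∃ t : Facet X d, s ≤ t.1) {w : X → ℝ}
    (hconn : (complexGrading X w).IsLocallyConnected d)
    {ω : Facet X d → ℝ} (hω : ∀ t, 0 < ω t)
    {ε : ℝ} (hε : ∀ s : X, s.1.card + 2 = d + 1 →
      IncEigenBound ω (linkInc (Subtype.val : Facet X d → X) s) (1 + ε)) (j : ℕ)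
    {x : grassmannianPosetification e X} (hx : Module.finrank F x.1 + (j + 2) = d + 1) :
    IncEigenBound ω (linkInc (fun t : Facet X d => coordFace e t.1) x)
      (spectralBound (Fintype.card F) ε j) := by
  have hV := isRegularPoset_grassmannian e hpure
  induction j generalizing x with
  | zero => exact grassmannian_incEigenBound_corank_two hX hpure hω hε hx
  | succ j ih =>
    have hr0 : d + 1 - Module.finrank F x.1 = j + 3 := by omega
    have hr1 : d + 1 - (Module.finrank F x.1 + 1) = j + 2 := by omega
    rw [spectralBound]
    split_ifs with hlt
    · have key := hV.incEigenBound_trickle hω (x := x) (by omega) ?_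
        (spectralBound_nonneg (Fintype.card F) ε j) ?_ ?_ ?_
      · simp only [hr1] at key
        exact key
      · simp only [hr0, hr1]
        rw [gaussNum_two, gaussNum_succ, Nat.add_sub_cancel]
      · simp only [hr1]
        exact hlt
      · intro y hy
        have := ((hV.covBy_iff _ _).1 hy).2
        exact ih (by omega)
      · intro f hf y y' hy hy'
        exact grassmannian_link_connected hX hpure hconn (by omega) f hf hy hy'
    · have key := hV.incEigenBound_trivial hω (x := x) (by omega)
      simp only [hr0] at key
      exact key

/-! ### Bounded degree -/

theorem ncard_facets_above_le {Q : ℕ}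
    (hpure : ∀ s : X, ∃ t : Facet X d, s ≤ t.1) (hX : IsSimplicialComplex X)
    (hQ : ∀ s : X, 0 < s.1.card → {t : X | s ≤ t ∧ t.1.card = s.1.card + 1}.ncard ≤ Q)
    (k : ℕ) {s : X} (hs : 0 < s.1.card) (hk : s.1.card + k = d + 1) :
    {t : X | s ≤ t ∧ t.1.card = d + 1}.ncard ≤ (Q + 1) ^ k := by
  classical
  have hC := isRegularPoset_complex hX hpure
  induction k generalizing s with
  | zero =>
    rw [pow_zero, Set.ncard_le_one]
    have : ∀ t ∈ {t : X | s ≤ t ∧ t.1.card = d + 1}, t = s := fun t ht =>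
      (Subtype.ext (Finset.eq_of_subset_of_card_le ht.1 (by rw [ht.2]; omega))).symm
    intro t ht t' ht'
    rw [this t ht, this t' ht']
  | succ k ih =>
    have hsub : {t : X | s ≤ t ∧ t.1.card = d + 1} ⊆
        ⋃ s' ∈ {t : X | s ≤ t ∧ t.1.card = s.1.card + 1}.toFinset,
          {t : X | s' ≤ t ∧ t.1.card = d + 1} := by
      rintro t ⟨hst, ht⟩
      have hlt : s < t := lt_of_le_of_ne hst fun h => by rw [← h] at ht; omega
      obtain ⟨s', hs', hs't⟩ := exists_covBy_le_of_lt hlt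
      simp only [Set.mem_iUnion, Set.mem_toFinset]
      exact ⟨s', (hC.covBy_iff _ _).1 hs', hs't, ht⟩
    refine (Set.ncard_le_ncard hsub (Set.toFinite _)).trans ?_
    refine (Finset.set_ncard_biUnion_le _ _).trans ?_
    refine (Finset.sum_le_card_nsmul _ _ ((Q + 1) ^ k) fun s' hs' => ?_).trans ?_
    · rw [Set.mem_toFinset] at hs'
      have := hs'.2
      exact ih (by omega) (by omega)
    · rw [← Set.ncard_eq_toFinset_card', smul_eq_mul, pow_succ']
      exact Nat.mul_le_mul_right _ ((hQ s hs).trans (Nat.le_succ Q))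

theorem ncard_le_coordFace_le (s : X) :
    {z : grassmannianPosetification e X | z ≤ coordFace e s}.ncard
      ≤ 2 ^ Fintype.card F ^ s.1.card := by
  have : Module.Finite F V := Module.Finite.of_basis e
  have hfin : Finite V := Module.finite_of_finite F
  have h1 : ((coordFace e s).1 : Set V).ncard = Fintype.card F ^ s.1.card := by
    rw [← Nat.card_coe_set_eq, ← Nat.card_eq_fintype_card, ← finrank_coordFace e]
    exact Module.natCard_eq_pow_finrank (K := F)
  rw [← h1, ← Set.ncard_powerset _ (Set.toFinite _)]
  refine Set.ncard_le_ncard_of_injOn (fun z => (z.1 : Set V)) (fun z hz => ?_) ?_ (Set.toFinite _)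
  · exact SetLike.coe_subset_coe.2 hz
  · intro z _ z' _ h
    exact Subtype.ext (SetLike.coe_injective h)

theorem ncard_covBy_grassmannian_le {Q : ℕ}
    (hpure : ∀ s : X, ∃ t : Facet X d, s ≤ t.1) (hX : IsSimplicialComplex X)
    (hQ : ∀ s : X, 0 < s.1.card → {t : X | s ≤ t ∧ t.1.card = s.1.card + 1}.ncard ≤ Q)
    {y : grassmannianPosetification e X} (hy : 0 < Module.finrank F y.1) :
    {z | y ⋖ z}.ncard ≤ (Q + 1) ^ (d + 1) * 2 ^ Fintype.card F ^ (d + 1) := by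
  classical
  have hV := isRegularPoset_grassmannian e hpure
  set s₀ : X := ⟨coordSupport e y.1, coordSupport_mem hX y⟩ with hs₀
  have hs₀c : 0 < s₀.1.card := hy.trans_le (finrank_le_card_coordSupport e y.1)
  obtain ⟨t₀, ht₀⟩ := hpure s₀
  have hs₀d : s₀.1.card ≤ d + 1 := t₀.2 ▸ Finset.card_le_card ht₀
  have hsub : {z | y ⋖ z} ⊆ ⋃ t ∈ {t : X | s₀ ≤ t ∧ t.1.card = d + 1}.toFinset,
      {z : grassmannianPosetification e X | z ≤ coordFace e t} := by
    intro z hz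
    obtain ⟨t, ht⟩ := hV.exists_le_top z
    simp only [Set.mem_iUnion, Set.mem_toFinset]
    exact ⟨t.1, ⟨le_coordFace_iff.1 (hz.le.trans ht), t.2⟩, ht⟩
  refine (Set.ncard_le_ncard hsub (Set.toFinite _)).trans ?_
  refine (Finset.set_ncard_biUnion_le _ _).trans ?_
  refine (Finset.sum_le_card_nsmul _ _ (2 ^ Fintype.card F ^ (d + 1)) fun t ht => ?_).trans ?_
  · rw [Set.mem_toFinset] at ht
    have := ncard_le_coordFace_le (e := e) t
    rwa [ht.2] at this
  · rw [← Set.ncard_eq_toFinset_card', smul_eq_mul]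
    refine Nat.mul_le_mul_right _ ?_
    refine (ncard_facets_above_le hpure hX hQ (d + 1 - s₀.1.card) hs₀c (by omega)).trans ?_
    exact Nat.pow_le_pow_right (Nat.succ_pos Q) (Nat.sub_le _ _)

end Grassmannian
/-- An upper bound for the excess over `(q - 1) / q` of the eigenvalue bounds for the adjacency
matrices of the links of corank at most `d + 2`: the sum of the absolute values of the excesses. -/
noncomputable def spectralExcess (ε : ℝ) (d q : ℕ) : ℝ :=
  ∑ j ∈ Finset.range (d + 1),
    |(spectralBound q ε j - 1) / (q * gaussNum q (j + 1)) - ((q : ℝ) - 1) / q|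

theorem tendsto_spectralExcess (d q : ℕ) :
    Tendsto (fun ε => spectralExcess ε d q) (𝓝 0) (𝓝 0) := by
  have h : ∀ j ∈ Finset.range (d + 1), Tendsto (fun ε =>
      |(spectralBound q ε j - 1) / (q * gaussNum q (j + 1)) - ((q : ℝ) - 1) / q|)
      (𝓝 0) (𝓝 0) := by
    intro j _
    have h1 := ((((tendsto_spectralBound q j).sub_const 1).div_const
      ((q : ℝ) * gaussNum q (j + 1))).sub_const (((q : ℝ) - 1) / q)).abs
    have h2 : (gaussNum q (j + 2) : ℝ) = gaussNum q (j + 1) + (q : ℝ) ^ (j + 1) := by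
      rw [gaussNum_succ']; push_cast; rfl
    have h3 : (gaussNum q (j + 2) : ℝ) = q * gaussNum q (j + 1) + 1 := by
      rw [gaussNum_succ]; push_cast; rfl
    have h4 : (q : ℝ) ^ (j + 1) - 1 = (q - 1) * gaussNum q (j + 1) := by linarith
    have h5 := one_le_gaussNum_succ q j
    rw [h4, mul_div_mul_right _ _ (by linarith), sub_self, abs_zero] at h1
    exact h1
  have h1 := tendsto_finsetSum (Finset.range (d + 1)) h
  simpa [spectralExcess] using h1

theorem le_spectralExcess {ε : ℝ} {d q j : ℕ} (hj : j ≤ d) :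
    (spectralBound q ε j - 1) / (q * gaussNum q (j + 1))
      ≤ ((q : ℝ) - 1) / q + spectralExcess ε d q := by
  have h1 := Finset.single_le_sum
    (f := fun j => |(spectralBound q ε j - 1) / (q * gaussNum q (j + 1)) - ((q : ℝ) - 1) / q|)
    (fun _ _ => abs_nonneg _) (Finset.mem_range.2 (Nat.lt_succ_of_le hj))
  have h2 := le_abs_self
    ((spectralBound q ε j - 1) / (q * gaussNum q (j + 1)) - ((q : ℝ) - 1) / q)
  simp only [spectralExcess]
  linarith

end PosetHDX

theorem mainTheorem2 :
    ∃ (B : ℕ → ℕ → ℕ → ℕ) (f : ℝ → ℕ → ℕ → ℝ),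
      (∀ d q : ℕ, Tendsto (fun ε => f ε d q) (𝓝 0) (𝓝 0)) ∧
      ∀ (q : ℕ) (F : Type*) [Field F] [Fintype F] (_ : Fintype.card F = q)
        (n d : ℕ) (V : Type*) [AddCommGroup V] [Module F V] (e : Module.Basis (Fin n) F V)
        (X : Finset (Finset (Fin n))) (w : X → ℝ) (ε : ℝ),
        PosetHDX.IsSimplicialComplex X →
        (PosetHDX.complexGrading X w).IsWeightedGraded d →
        (PosetHDX.complexGrading X w).IsLocallyConnected d →
        (∀ s : X, (PosetHDX.complexGrading X w).rk s = (d : ℤ) - 2 →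
          ((PosetHDX.complexGrading X w).link s).IsRegularBipartite ∧
          ∀ c : ℝ, ((PosetHDX.complexGrading X w).link s).IsNontrivialEigenvalue c → c ≤ ε) →
        -- `V_X` is a pure weighted graded poset of rank `d`, graded by `dim - 1`,
        -- and a subposet of the poset of subspaces of `V`
        (PosetHDX.grassmannianGrading e X w).IsWeightedGraded d ∧
        (∀ y z : PosetHDX.grassmannianPosetification e X,
          y ≤ z ↔ (y : Submodule F V) ≤ (z : Submodule F V)) ∧
        -- bounded degree
        (∀ Q : ℕ,
          (∀ s : X, 0 ≤ (PosetHDX.complexGrading X w).rk s →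
            {t : X | s ≤ t ∧ (PosetHDX.complexGrading X w).rk t =
              (PosetHDX.complexGrading X w).rk s + 1}.ncard ≤ Q) →
          ∀ y : PosetHDX.grassmannianPosetification e X,
            0 ≤ (PosetHDX.grassmannianGrading e X w).rk y →
            {z : PosetHDX.grassmannianPosetification e X | y ⋖ z ∧
              (PosetHDX.grassmannianGrading e X w).rk z =
                (PosetHDX.grassmannianGrading e X w).rk y + 1}.ncard ≤ B q Q d) ∧
        -- spectra of the links
        (∀ x : PosetHDX.grassmannianPosetification e X,
          (PosetHDX.grassmannianGrading e X w).rk x ≤ (d : ℤ) - 2 →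
          (∀ c : ℝ, ((PosetHDX.grassmannianGrading e X w).link x).IsNontrivialEigenvalue c →
            c ≤ ((q : ℝ) - 1) / q + f ε d q) ∧
          (∀ c : ℝ, ((PosetHDX.grassmannianGrading e X w).link x).IsEigenvalue c →
            -(1 / (q : ℝ)) ≤ c)) := by
  classical
  open PosetHDX in
  refine ⟨fun q Q d => (Q + 1) ^ (d + 1) * 2 ^ q ^ (d + 1), spectralExcess,
    tendsto_spectralExcess, ?_⟩
  intro q F _ _ hq n d V _ _ e X w ε hX hgraded hconn hlink
  have hpure : ∀ s : X, ∃ t : Facet X d, s ≤ t.1 := by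
    intro s
    obtain ⟨t, hst, ht⟩ := hgraded.pure s
    have ht' : (t.1.card : ℤ) - 1 = d := ht
    exact ⟨⟨t, by omega⟩, hst⟩
  have hC := isRegularPoset_complex hX hpure
  have hV := isRegularPoset_grassmannian e hpure
  rw [hq] at hV
  have hτ : ∀ t : Facet X d,
      ∑ I : X, (if coordSpan e I.1 = (coordFace e t.1).1 then w I else 0) = w t.1 :=
    fun t => sum_ite_coordSpan_eq e w t.1
  have hω : ∀ t : Facet X d, 0 < w t.1 := by
    intro t
    have h1 : 0 < standardWeight w t.1 := hgraded.m_pos t.1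
    rwa [standardWeight, if_pos (hC.isMax_top t)] at h1
  have hq1 : 1 < q := hq ▸ Fintype.one_lt_card
  have hq0 : (0 : ℝ) < q := by positivity
  refine ⟨?_, fun y z => Iff.rfl, ?_, ?_⟩
  · have hempty : standardWeight w (⟨∅, hX.empty_mem⟩ : X) = 1 := by
      refine hgraded.m_bot ⟨∅, hX.empty_mem⟩ ?_
      simp [complexGrading, standardGrading]
    let o : grassmannianPosetification e X := ⟨⊥, ∅, hX.empty_mem, bot_le⟩
    have hfin : Module.Finite F V := Module.Finite.of_basis e
    refine hV.isWeightedGraded _ ?_ o (fun x => ?_) ?_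
    · intro t
      rw [hτ]
      exact hω t
    · rw [Submodule.finrank_eq_zero, Subtype.ext_iff]
    · rw [hC.standardWeight_eq] at hempty
      rw [hV.standardWeight_eq]
      have h1 : Module.finrank F o.1 = 0 := finrank_bot F V
      have h2 := rankFactor_zero (g := gaussNum q) (fun _ => gaussNum_pos q) (d + 1)
      have h3 := rankFactor_zero (g := fun i => i) (fun _ h => h) (d + 1)
      rw [h1, h2, one_mul]
      rw [Finset.card_empty, h3, one_mul] at hempty
      rw [← hempty]
      simp only [topWeight]
      refine Finset.sum_congr rfl fun t _ => ?_
      rw [if_pos (show o ≤ coordFace e t.1 from bot_le (a := (coordFace e t.1).1)),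
        if_pos (show (⟨∅, hX.empty_mem⟩ : X) ≤ t.1 from Finset.empty_subset _), hτ]
  · intro Q hQ y hy
    have hy' : (0 : ℤ) ≤ (Module.finrank F y.1 : ℤ) - 1 := hy
    have hQ' : ∀ s : X, 0 < s.1.card → {t : X | s ≤ t ∧ t.1.card = s.1.card + 1}.ncard ≤ Q := by
      intro s hs
      refine le_trans (Set.ncard_le_ncard ?_ (Set.toFinite _)) (hQ s ?_)
      · rintro t ⟨hst, ht⟩
        refine ⟨hst, ?_⟩
        change (t.1.card : ℤ) - 1 = (s.1.card : ℤ) - 1 + 1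
        omega
      · change (0 : ℤ) ≤ (s.1.card : ℤ) - 1
        omega
    have h1 := ncard_covBy_grassmannian_le hpure hX hQ' (y := y) (by omega)
    rw [hq] at h1
    exact (Set.ncard_le_ncard (fun z hz => hz.1) (Set.toFinite _)).trans h1
  · intro x hx
    have hx' : (Module.finrank F x.1 : ℤ) - 1 ≤ (d : ℤ) - 2 := hx
    obtain ⟨j, hj⟩ : ∃ j, Module.finrank F x.1 + (j + 2) = d + 1 :=
      ⟨d - 1 - Module.finrank F x.1, by omega⟩
    have hr1 : d + 1 - (Module.finrank F x.1 + 1) = j + 1 := by omega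
    have hk : ((gaussNum q 2 : ℕ) : ℝ) - 1 = q := by
      rw [gaussNum_two]; push_cast; ring
    have hg := one_le_gaussNum_succ q j
    have hpos : (0 : ℝ) < q * gaussNum q (j + 1) := by positivity
    constructor
    · intro c hc
      have hbound : ∀ s : X, s.1.card + 2 = d + 1 →
          IncEigenBound (fun t : Facet X d => w t.1)
            (linkInc (Subtype.val : Facet X d → X) s) (1 + ε) := by
        intro s hs
        have h1 := hC.incEigenBound_of_isNontrivialEigenvalue (x := s) hω (by omega)
          (hlink s (by
            change (s.1.card : ℤ) - 1 = _
            omega)).2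
        rw [show d + 1 - (s.1.card + 1) = 1 by omega] at h1
        norm_num at h1
        exact h1
      have h1 := grassmannian_incEigenBound (e := e) hX hpure hconn hω hbound j hj
      rw [hq] at h1
      have h2 := hV.isNontrivialEigenvalue_le (x := x)
        (w := fun y => ∑ I : X, if coordSpan e I.1 = y.1 then w I else 0)
        (fun t => by rw [hτ]; exact hω t) (by omega)
        (β := spectralBound q ε j) (by simp only [hτ]; exact h1) hc
      simp only [hr1, hk] at h2
      refine le_trans ?_ (le_spectralExcess (show j ≤ d by omega))
      rw [le_div_iff₀ hpos]
      linarith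
    · intro c hc
      have h2 := hV.isEigenvalue_ge (x := x)
        (w := fun y => ∑ I : X, if coordSpan e I.1 = y.1 then w I else 0)
        (fun t => by rw [hτ]; exact hω t) (by omega) hc
      simp only [hr1, hk] at h2
      by_contra! hlt
      have h3 : c * q < -1 := by
        have := mul_lt_mul_of_pos_right hlt hq0
        rwa [neg_mul, one_div, inv_mul_cancel₀ hq0.ne'] at this
      nlinarith
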